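/- **Proposition 5.4 (intersection of butterflies).** Let $\mathfrak g$ be a finite-dimensional real Lie algebra with a Euclidean scalar product $Q$ such that $Q([X,Y],Z)=Q(X,[Y,Z])$ (so $\mathfrak g$ is compact), let $\mathfrak h\subset\mathfrak g$ be a subalgebra, and let $\mathcal A$ be a group of automorphisms of $\mathfrak g$ preserving $\mathfrak h$ and $Q$. For a subalgebra $\mathfrak f<\mathfrak g$ put $\bar\chi^{\mathfrak f}=\frac1{\dim(\mathfrak g/\mathfrak f)}(1_{\mathfrak g}-1_{\mathfrak f})$, where $1_{\mathfrak f}$ is the $Q$-orthogonal projector onto $\mathfrak f$. Let $\mathcal S$ be the set of $Q$-symmetric operators $T\ge 0$ on $\mathfrak g$ with $\operatorname{tr}T=1$ that commute with $\mathcal A$. *Cells.* For $T\in\mathcal S$ and $a\in\mathbb R$ let $F_a$ be the span of the eigenvectors of $T$ with eigenvalue $\le a$. Let $W$ be the set of $T\in\mathcal S$ with $[F_a,F_b]\subset F_{a+b}$ for all $a,b\in\mathbb R$ and $\mathfrak h<F_0=\ker T<\mathfrak g$ (strict inclusions). Let $W_{\rm draft}$ be the set of $T\in\mathcal S$ such that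 $TX=0$ and $T\operatorname{ad}X=\operatorname{ad}X\,T$ for all $X\in\mathfrak h$ and for at least one $X\in\mathfrak g\setminus\mathfrak h$. For an $\mathcal A$-invariant subalgebra $\mathfrak f$ with $\mathfrak h<\mathfrak f<\mathfrak g$ put $$X[\mathfrak f]=\{T\in W: T\mathfrak f=0\},\qquad D[\mathfrak f]=\{T\in W_{\rm draft}: T\mathfrak f=0,\ [T,\operatorname{ad}\mathfrak f]=0\}.$$ *Butterflies.* A flag is a finite sequence $\varphi=(\mathfrak f_1>\dots>\mathfrak f_r)$, $r\ge1$, of $\mathcal A$-invariant subalgebras with $\mathfrak h<\mathfrak f_i\le\mathfrak g$, identified with the set of its members; $\ell(\varphi)=r$, $\max\varphi=\mathfrak f_1$. Let $B$ stand for $X$ or for $D$. The butterfly $B[\varphi]$ is: for $r=1$, the cell $B[\mathfrak f_1]$ if $\mathfrak f_1\neq\mathfrak g$, and $\emptyset$ if $\mathfrak f_1=\mathfrak g$; for $r>1$ and $\mathfrak f_1=\mathfrak g$, the convex hull of $\bar\chi^{\mathfrak f_2},\dots,\bar\chi^{\mathfrak f_r}$; for $r>1$ and $\mathfrak f_1\ne\mathfrak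 g$, the union of all segments joining a point of $B[\mathfrak f_1]$ to a point of the convex hull of $\bar\chi^{\mathfrak f_2},\dots,\bar\chi^{\mathfrak f_r}$. *Product and order.* For flags $\varphi,\psi$ let $$\varphi\psi=(\psi\cap\varphi)\cup\{\mathfrak f\in\varphi:\mathfrak f>\max\psi\}\cup\{\mathfrak f\in\psi:\mathfrak f>\max\varphi\}\cup\{\sup(\varphi\cup\psi)\},$$ where $\sup$ is the subalgebra generated by all members; this is again a flag. Write $\varphi\le\psi$ if there is a finite sequence of flags $\psi=\varphi_1,\dots,\varphi_k=\varphi$, $k\ge1$, such that for each $i<k$ the lengths of $\varphi_i$ and $\varphi_{i+1}$ differ by $1$ and either $\varphi_{i+1}\subset\varphi_i$ and $\max\varphi_i>\max\varphi_{i+1}$, or $\varphi_{i+1}\supset\varphi_i$ and $\max\varphi_i=\max\varphi_{i+1}$. *Claim.* The intersection of any two butterflies is again a butterfly: both for $B=X$ and for $B=D$, and for all flags $\varphi,\psi$, $$B[\varphi]\cap B[\psi]=B[\varphi\psi].$$ The product of flags is commutative, associative and idempotent. The relation $\le$ is a partial order on flags; $\varphi\le\psi$ holds if and only if $\max\varphi\le\max\psi$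 and every $\mathfrak l\in\psi$ with $\mathfrak l\notin\varphi$ satisfies $\mathfrak l>\max\varphi$; and $\varphi\psi$ is the least upper bound of $\varphi$ and $\psi$ with respect to $\le$. -/

import Mathlib

namespace ButterflyFlags

noncomputable section

/-- The standing data on a finite-dimensional real Lie algebra `g`: an invariant Euclidean scalar
product `Q` (so that `g` is a compact Lie algebra), a subalgebra `h`, and a group `A` of
automorphisms of the Lie algebra `g` preserving `Q` and `h`. -/
structure InvariantData (g : Type*) [LieRing g] [LieAlgebra ℝ g] where
  Q : LinearMap.BilinForm ℝ g
  symm : ∀ X Y, Q X Y = Q Y X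
  pos : ∀ X, X ≠ 0 → 0 < Q X X
  invariant : ∀ X Y Z, Q ⁅X, Y⁆ Z = Q X ⁅Y, Z⁆
  h : LieSubalgebra ℝ g
  A : Subgroup (g ≃ₗ[ℝ] g)
  map_lie : ∀ a ∈ A, ∀ X Y, a ⁅X, Y⁆ = ⁅a X, a Y⁆
  map_Q : ∀ a ∈ A, ∀ X Y, Q (a X) (a Y) = Q X Y
  map_h : ∀ a ∈ A, ∀ X ∈ h, a X ∈ h

variable {g : Type*} [LieRing g] [LieAlgebra ℝ g]

namespace InvariantData

/-- `f` is invariant under the group `A`. -/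
def IsInvariant (S : InvariantData g) (f : LieSubalgebra ℝ g) : Prop :=
  ∀ a ∈ S.A, ∀ X ∈ f, a X ∈ f

/-- The subalgebra generated by a family of invariant subalgebras is invariant, i.e. suprema in the
lattice of invariant subalgebras are computed in the lattice of all subalgebras. -/
theorem isInvariant_sSup (S : InvariantData g) (s : Set (LieSubalgebra ℝ g))
    (hs : ∀ f ∈ s, S.IsInvariant f) : S.IsInvariant (sSup s) := by
  intro a ha
  let F : g →ₗ⁅ℝ⁆ g := { a.toLinearMap with map_lie' := fun {X Y} => S.map_lie a ha X Y }
  have key : sSup s ≤ (sSup s).comap F := by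
    refine sSup_le fun f hf X hX => ?_
    exact (le_sSup hf : f ≤ sSup s) (hs f hf a ha X hX)
  exact fun X hX => key hX

/-- `g` is the direct sum of a subspace and its `Q`-orthogonal complement. -/
theorem isCompl_orthogonal [FiniteDimensional ℝ g] (S : InvariantData g) (f : Submodule ℝ g) :
    IsCompl f (S.Q.orthogonal f) := by
  have hr : S.Q.IsRefl := fun X Y hXY => by rw [S.symm, hXY]
  rw [LinearMap.BilinForm.isCompl_orthogonal_iff_disjoint hr, Submodule.disjoint_def]
  intro X hX hX'
  by_contra h0
  have h1 : S.Q X X = 0 := LinearMap.BilinForm.mem_orthogonal_iff.1 hX' X hX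
  exact (S.pos X h0).ne' h1

/-- The orthogonal projector `1_f` of `g` onto `f`. -/
def orthProj [FiniteDimensional ℝ g] (S : InvariantData g) (f : LieSubalgebra ℝ g) :
    Module.End ℝ g :=
  f.toSubmodule.projection (S.Q.orthogonal f.toSubmodule) (S.isCompl_orthogonal f.toSubmodule)

/-- The operator `χ̄^f = (1_g - 1_f) / dim (g / f)` (used only for proper subalgebras `f`). -/
def chiBar [FiniteDimensional ℝ g] (S : InvariantData g) (f : LieSubalgebra ℝ g) :
    Module.End ℝ g :=
  ((Module.finrank ℝ (g ⧸ f.toSubmodule) : ℝ))⁻¹ • (1 - S.orthProj f)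

/-- The span `F_a` of all eigenvectors of `T` with eigenvalue at most `a`. -/
def filt (T : Module.End ℝ g) (a : ℝ) : Submodule ℝ g :=
  Submodule.span ℝ {X | ∃ r ≤ a, T X = r • X}

/-- `Q`-symmetric operators with nonnegative spectrum and trace `1` that commute with `A`. -/
def IsState (S : InvariantData g) (T : Module.End ℝ g) : Prop :=
  (∀ X Y, S.Q (T X) Y = S.Q X (T Y)) ∧ (∀ X, 0 ≤ S.Q (T X) X) ∧
    LinearMap.trace ℝ g T = 1 ∧ ∀ a ∈ S.A, ∀ X, T (a X) = a (T X)

/-- The family `(F_a)` is a filtration of the Lie algebra. -/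
def IsFiltering (T : Module.End ℝ g) : Prop :=
  ∀ a b : ℝ, ∀ X ∈ filt T a, ∀ Y ∈ filt T b, ⁅X, Y⁆ ∈ filt T (a + b)

/-- The space `W` of invariant nonnegative filtering operators of trace `1` that are degenerate
relative to `h`, that is, `h < F_0 = ker T < g`. -/
def W (S : InvariantData g) : Set (Module.End ℝ g) :=
  {T | S.IsState T ∧ IsFiltering T ∧ S.h.toSubmodule < filt T 0 ∧
    filt T 0 = LinearMap.ker T ∧ LinearMap.ker T < ⊤}

/-- `T X = 0` and `T` commutes with `ad X`. -/
def KillsAndCommutes (T : Module.End ℝ g) (X : g) : Prop :=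
  T X = 0 ∧ ∀ Y, T ⁅X, Y⁆ = ⁅X, T Y⁆

/-- The draft version of `W`. -/
def WDraft (S : InvariantData g) : Set (Module.End ℝ g) :=
  {T | S.IsState T ∧ (∀ X ∈ S.h, KillsAndCommutes T X) ∧ ∃ X, X ∉ S.h ∧ KillsAndCommutes T X}

/-- The set `X[f]` of the operators in `W` that annihilate `f`. -/
def cellX (S : InvariantData g) (f : LieSubalgebra ℝ g) : Set (Module.End ℝ g) :=
  {T | T ∈ S.W ∧ ∀ X ∈ f, T X = 0}

/-- The cell `D[f]` of the operators in the draft version of `W` that annihilate `f` and commute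
with `ad f`. -/
def cellD (S : InvariantData g) (f : LieSubalgebra ℝ g) : Set (Module.End ℝ g) :=
  {T | T ∈ S.WDraft ∧ ∀ X ∈ f, KillsAndCommutes T X}

/-- A flag `f₁ > ... > f_r`, `r ≥ 1`, of invariant subalgebras `f_i` with `h < f_i ≤ g`, viewed as
the set of its members. -/
@[ext]
structure Flag (S : InvariantData g) where
  carrier : Set (LieSubalgebra ℝ g)
  nonempty : carrier.Nonempty
  finite : carrier.Finite
  chain : IsChain (· ≤ ·) carrier
  inv : ∀ f ∈ carrier, S.IsInvariant f
  h_lt : ∀ f ∈ carrier, S.h < f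

namespace Flag

variable {S : InvariantData g}

/-- The number of members of the flag. -/
def length (φ : Flag S) : ℕ := φ.carrier.ncard

/-- The largest member of the flag, see `isGreatest_max`. -/
def max (φ : Flag S) : LieSubalgebra ℝ g := sSup φ.carrier

theorem isGreatest_max (φ : Flag S) : IsGreatest φ.carrier φ.max := by
  obtain ⟨m, hm⟩ := φ.finite.exists_maximal φ.nonempty
  have hg : IsGreatest φ.carrier m := by
    refine ⟨hm.1, fun f hf => ?_⟩
    rcases φ.chain.total hf hm.1 with h | h
    · exact h
    · exact hm.2 hf h
  have : φ.max = m := hg.isLUB.sSup_eq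
  rwa [this]

/-- The product of flags: the union of `ψ ∩ φ`, `{f ∈ φ : f > max ψ}`, `{f ∈ ψ : f > max φ}` and
`{sup (φ ∪ ψ)}`. -/
instance : Mul (Flag S) where
  mul φ ψ :=
    { carrier := (ψ.carrier ∩ φ.carrier) ∪ {f ∈ φ.carrier | ψ.max < f} ∪
        {f ∈ ψ.carrier | φ.max < f} ∪ {sSup (φ.carrier ∪ ψ.carrier)}
      nonempty := ⟨_, Or.inr rfl⟩
      finite := (((φ.finite.inter_of_right _).union (φ.finite.subset (Set.sep_subset _ _))).union
        (ψ.finite.subset (Set.sep_subset _ _))).union (Set.finite_singleton _)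
      chain := by
        have top : ∀ f ∈ (ψ.carrier ∩ φ.carrier) ∪ {f ∈ φ.carrier | ψ.max < f} ∪
            {f ∈ ψ.carrier | φ.max < f}, f ≤ sSup (φ.carrier ∪ ψ.carrier) := by
          rintro f ((hf | hf) | hf)
          · exact le_sSup (Or.inl hf.2)
          · exact le_sSup (Or.inl hf.1)
          · exact le_sSup (Or.inr hf.1)
        have tot : ∀ f ∈ (ψ.carrier ∩ φ.carrier) ∪ {f ∈ φ.carrier | ψ.max < f} ∪
            {f ∈ ψ.carrier | φ.max < f}, ∀ l ∈ (ψ.carrier ∩ φ.carrier) ∪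
            {f ∈ φ.carrier | ψ.max < f} ∪ {f ∈ ψ.carrier | φ.max < f}, f ≤ l ∨ l ≤ f := by
          rintro f ((hf | hf) | hf) l ((hl | hl) | hl)
          · exact φ.chain.total hf.2 hl.2
          · exact φ.chain.total hf.2 hl.1
          · exact ψ.chain.total hf.1 hl.1
          · exact φ.chain.total hf.1 hl.2
          · exact φ.chain.total hf.1 hl.1
          · exact Or.inr ((ψ.isGreatest_max.2 hl.1).trans hf.2.le)
          · exact ψ.chain.total hf.1 hl.1
          · exact Or.inr ((φ.isGreatest_max.2 hl.1).trans hf.2.le)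
          · exact ψ.chain.total hf.1 hl.1
        rintro f (hf | rfl) l (hl | rfl) -
        · exact tot f hf l hl
        · exact Or.inl (top f hf)
        · exact Or.inr (top l hl)
        · exact Or.inl le_rfl
      inv := by
        rintro f (((hf | hf) | hf) | rfl)
        · exact φ.inv f hf.2
        · exact φ.inv f hf.1
        · exact ψ.inv f hf.1
        · refine S.isInvariant_sSup _ ?_
          rintro l (hl | hl)
          · exact φ.inv l hl
          · exact ψ.inv l hl
      h_lt := by
        rintro f (((hf | hf) | hf) | rfl)
        · exact φ.h_lt f hf.2
        · exact φ.h_lt f hf.1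
        · exact ψ.h_lt f hf.1
        · obtain ⟨l, hl⟩ := φ.nonempty
          exact (φ.h_lt l hl).trans_le (le_sSup (Or.inl hl)) }

/-- An elementary descending step from `ψ` to `φ` for the nonstandard order: the lengths differ by
one, and either the largest member of `ψ` has been removed, or a member has been inserted that does
not change the largest one. -/
def Step (ψ φ : Flag S) : Prop :=
  (ψ.length = φ.length + 1 ∧ φ.carrier ⊆ ψ.carrier ∧ φ.max < ψ.max) ∨
    (φ.length = ψ.length + 1 ∧ ψ.carrier ⊆ φ.carrier ∧ φ.max = ψ.max)

/-- The nonstandard order: `φ ≤ ψ` if a (possibly empty) finite sequence of elementary steps leads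
from `ψ` down to `φ`. -/
instance : LE (Flag S) where
  le φ ψ := Relation.ReflTransGen Step ψ φ

end Flag

open Classical in
/-- The butterfly of a flag `φ = (f₁ > ... > f_r)` built from a family `V` of cells:
* first kind, `r = 1`: the cell `V f₁`, and the empty set if `f₁ = g`;
* second kind, `r > 1` and `f₁ = g`: the simplex spanned by all `χ̄^f`, `f ∈ φ`, `f ≠ g`;
* third kind, `r > 1` and `f₁ ≠ g`: the union of all segments joining a point of `V f₁` to a point
  of the simplex spanned by all `χ̄^f`, `f ∈ φ`, `f ≠ f₁`. -/
def butterfly [FiniteDimensional ℝ g] (S : InvariantData g)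
    (V : LieSubalgebra ℝ g → Set (Module.End ℝ g)) (φ : Flag S) : Set (Module.End ℝ g) :=
  if φ.length = 1 then
    if φ.max = ⊤ then ∅ else V φ.max
  else if ⊤ ∈ φ.carrier then
    convexHull ℝ (S.chiBar '' (φ.carrier \ {⊤}))
  else
    convexJoin ℝ (V φ.max) (convexHull ℝ (S.chiBar '' (φ.carrier \ {φ.max})))

/-- The butterfly `X[φ]`, lying in `W`. -/
def butterflyX [FiniteDimensional ℝ g] (S : InvariantData g) (φ : Flag S) :
    Set (Module.End ℝ g) := S.butterfly S.cellX φ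

/-- The butterfly `D[φ]`, lying in the draft version of `W`. -/
def butterflyD [FiniteDimensional ℝ g] (S : InvariantData g) (φ : Flag S) :
    Set (Module.End ℝ g) := S.butterfly S.cellD φ

end InvariantData

end

end ButterflyFlags

namespace ButterflyFlags

noncomputable section

namespace InvariantData

variable {g : Type*} [LieRing g] [LieAlgebra ℝ g] {S : InvariantData g}

/-! ### Combinatorics of flags: the explicit order and least upper bounds. -/

namespace Flag

/-! Membership in a butterfly depends only on the eigenvalue filtration `filt T`. If `f ≤ ker T` and
`c > 0`, adding `c (1 - 1_f)` to a nonnegative `T` makes the filtration equal to `f` on `[0, c)` and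
shifts the old one by `c`. Conversely, subtracting the least positive eigenvalue times the projector
onto `(ker T)ᗮ` removes the first step (`exists_peel`). Hence a trace-one `T` lies in the butterfly
of `φ` iff it is `Layered`: up to some level `l` the filtration runs through members of `φ` other
than the largest; from `l` on it contains `φ.max`, and the shifted filtration satisfies the cell
condition (`mem_butterfly_iff`).

The intersection formula then compares levels `l ≤ m` of two flags along one filtration. Below `l`
its terms belong to both flags; on `[l, m)` they belong to the second and contain the maximum of the
first; these are the pieces of the product. The level of the product is `m` (`layered_mul_iff`). The
two versions differ only in the cell condition, so its required stability properties are isolated in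
`CellRule` and checked for filterings and for commutation with `ad`.

For the order, `Below` is visibly a partial order, and it agrees with the order generated by steps
because the union of two comparable flags is again a flag, reached by insertions and left by
removals from the top. The product is the least upper bound, whence idempotence and associativity.
-/

theorem max_mem (φ : Flag S) : φ.max ∈ φ.carrier := φ.isGreatest_max.1

theorem le_max (φ : Flag S) {f : LieSubalgebra ℝ g} (hf : f ∈ φ.carrier) : f ≤ φ.max :=
  φ.isGreatest_max.2 hf

theorem sSup_union (φ ψ : Flag S) : sSup (φ.carrier ∪ ψ.carrier) = φ.max ⊔ ψ.max :=
  _root_.sSup_union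

theorem mem_mul {φ ψ : Flag S} {f : LieSubalgebra ℝ g} :
    f ∈ (φ * ψ).carrier ↔ (f ∈ φ.carrier ∧ f ∈ ψ.carrier) ∨ (f ∈ φ.carrier ∧ ψ.max < f) ∨
      (f ∈ ψ.carrier ∧ φ.max < f) ∨ f = φ.max ⊔ ψ.max := by
  rw [← sSup_union]
  change (((f ∈ ψ.carrier ∧ f ∈ φ.carrier) ∨ _) ∨ _) ∨ _ ↔ _
  simp only [Set.mem_ofPred_eq, Set.mem_singleton_iff]
  tauto

theorem max_mul (φ ψ : Flag S) : (φ * ψ).max = φ.max ⊔ ψ.max := by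
  refine le_antisymm ?_ ((φ * ψ).le_max (mem_mul.2 (by simp)))
  rcases mem_mul.1 (φ * ψ).max_mem with h | h | h | h
  · exact (φ.le_max h.1).trans le_sup_left
  · exact (φ.le_max h.1).trans le_sup_left
  · exact (ψ.le_max h.1).trans le_sup_right
  · exact h.le

/-- The explicit description of the nonstandard order. -/
def Below (φ ψ : Flag S) : Prop :=
  φ.max ≤ ψ.max ∧ ∀ l ∈ ψ.carrier, l ∉ φ.carrier → φ.max < l

theorem Below.refl (φ : Flag S) : φ.Below φ := ⟨le_rfl, fun _ h h' => (h' h).elim⟩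

theorem Below.trans {φ ψ χ : Flag S} (h₁ : φ.Below ψ) (h₂ : ψ.Below χ) : φ.Below χ := by
  refine ⟨h₁.1.trans h₂.1, fun l hl hl' => ?_⟩
  by_cases h : l ∈ ψ.carrier
  · exact h₁.2 l h hl'
  · exact h₁.1.trans_lt (h₂.2 l hl h)

theorem Below.antisymm {φ ψ : Flag S} (h₁ : φ.Below ψ) (h₂ : ψ.Below φ) : φ = ψ := by
  refine Flag.ext (Set.Subset.antisymm (fun l hl => ?_) (fun l hl => ?_)) <;> by_contra h
  · exact (h₂.2 l hl h).not_ge ((φ.le_max hl).trans h₁.1)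
  · exact (h₁.2 l hl h).not_ge ((ψ.le_max hl).trans h₂.1)

theorem Step.below {ψ φ : Flag S} (h : Step ψ φ) : φ.Below ψ := by
  rcases h with ⟨hlen, hsub, hlt⟩ | ⟨-, hsub, heq⟩
  · refine ⟨hlt.le, fun l hl hl' => ?_⟩
    have hd : (ψ.carrier \ φ.carrier).ncard = 1 := by
      rw [Set.ncard_sdiff hsub φ.finite]
      unfold length at hlen
      omega
    obtain ⟨x, hx⟩ := Set.ncard_eq_one.1 hd
    have h1 : l ∈ ψ.carrier \ φ.carrier := ⟨hl, hl'⟩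
    -- Only one member is lost, and `ψ.max` is lost, so the missing `l` is `ψ.max`.
    have h2 : ψ.max ∈ ψ.carrier \ φ.carrier := ⟨ψ.max_mem, fun h => hlt.not_ge (φ.le_max h)⟩
    rw [hx, Set.mem_singleton_iff] at h1 h2
    rwa [h1, ← h2]
  · exact ⟨heq.le, fun l hl hl' => (hl' (hsub hl)).elim⟩

theorem below_of_le {φ ψ : Flag S} (h : φ ≤ ψ) : φ.Below ψ := by
  change Relation.ReflTransGen Step ψ φ at h
  induction h with
  | refl => exact Below.refl _
  | tail _ hs ih => exact hs.below.trans ih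

/-- The flag obtained by removing one of several members. -/
def erase (φ : Flag S) (x : LieSubalgebra ℝ g) (hx : (φ.carrier \ {x}).Nonempty) : Flag S where
  carrier := φ.carrier \ {x}
  nonempty := hx
  finite := φ.finite.sdiff
  chain := φ.chain.mono Set.sdiff_subset
  inv f hf := φ.inv f hf.1
  h_lt f hf := φ.h_lt f hf.1

theorem length_erase (φ : Flag S) {x : LieSubalgebra ℝ g} (hx : (φ.carrier \ {x}).Nonempty)
    (hmem : x ∈ φ.carrier) : φ.length = (φ.erase x hx).length + 1 :=
  (Set.ncard_sdiff_singleton_add_one hmem φ.finite).symm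

theorem le_of_subset_of_max_eq {χ ψ : Flag S} (hsub : ψ.carrier ⊆ χ.carrier)
    (hmax : χ.max = ψ.max) : χ ≤ ψ := by
  change Relation.ReflTransGen Step ψ χ
  induction hn : χ.length generalizing χ with
  | zero =>
    exact absurd ((Set.ncard_eq_zero χ.finite).1 hn) χ.nonempty.ne_empty
  | succ n ih =>
    by_cases heq : χ.carrier ⊆ ψ.carrier
    · rw [Flag.ext (hsub.antisymm heq)]
    · obtain ⟨x, hx, hx'⟩ := Set.not_subset.1 heq
      -- The member to be erased is not the largest, so its reinsertion is a legal step.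
      have hne : χ.max ≠ x := fun h => hx' (h ▸ hmax ▸ ψ.max_mem)
      have hmem : χ.max ∈ χ.carrier \ {x} := ⟨χ.max_mem, hne⟩
      have hm : (χ.erase x ⟨_, hmem⟩).max = χ.max :=
        le_antisymm (χ.le_max (χ.erase x ⟨_, hmem⟩).max_mem.1)
          ((χ.erase x ⟨_, hmem⟩).le_max hmem)
      have hlen := χ.length_erase ⟨_, hmem⟩ hx
      refine (ih (χ := χ.erase x ⟨_, hmem⟩) (fun f hf => ⟨hsub hf, fun h => hx' ?_⟩)
        (hm.trans hmax) (by omega)).tail (Or.inr ⟨hlen, Set.sdiff_subset, hm.symm⟩)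
      rw [Set.mem_singleton_iff] at h
      exact h ▸ hf

/-- Every extra member lies above `φ.max`, so the extra members can be stripped from the top one at
a time. -/
theorem le_of_subset_of_lt {χ φ : Flag S} (hsub : φ.carrier ⊆ χ.carrier)
    (hlt : ∀ l ∈ χ.carrier, l ∉ φ.carrier → φ.max < l) : φ ≤ χ := by
  change Relation.ReflTransGen Step χ φ
  induction hn : χ.length generalizing χ with
  | zero =>
    exact absurd ((Set.ncard_eq_zero χ.finite).1 hn) χ.nonempty.ne_empty
  | succ n ih =>
    by_cases heq : χ.carrier ⊆ φ.carrier
    · rw [Flag.ext (hsub.antisymm heq)]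
    · obtain ⟨x, hx, hx'⟩ := Set.not_subset.1 heq
      have hφχ : φ.max < χ.max := (hlt x hx hx').trans_le (χ.le_max hx)
      have hsub' : φ.carrier ⊆ χ.carrier \ {χ.max} :=
        fun f hf => ⟨hsub hf, fun h => hφχ.not_ge (h ▸ φ.le_max hf)⟩
      have hne := φ.nonempty.mono hsub'
      have hlen := χ.length_erase hne χ.max_mem
      refine Relation.ReflTransGen.head (Or.inl ⟨hlen, Set.sdiff_subset, ?_⟩)
        (ih (χ := χ.erase χ.max hne) hsub' (fun l hl => hlt l hl.1) (by omega))
      have h := (χ.erase χ.max hne).max_mem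
      exact lt_of_le_of_ne (χ.le_max h.1) h.2

theorem Below.le {φ ψ : Flag S} (h : φ.Below ψ) : φ ≤ ψ := by
  have hcmp : ∀ l ∈ ψ.carrier, l ∈ φ.carrier ∨ φ.max < l := fun l hl =>
    or_iff_not_imp_left.2 (h.2 l hl)
  -- The sequence of steps passes through the union: members of `φ` are inserted into `ψ` below its
  -- maximum, then the members outside `φ` are removed from the top.
  let χ : Flag S :=
    { carrier := ψ.carrier ∪ φ.carrier
      nonempty := φ.nonempty.inr
      finite := ψ.finite.union φ.finite
      chain := by
        have key : ∀ l ∈ ψ.carrier, ∀ f ∈ φ.carrier, l ≤ f ∨ f ≤ l := fun l hl f hf =>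
          (hcmp l hl).elim (fun h => φ.chain.total h hf)
            (fun h => Or.inr ((φ.le_max hf).trans h.le))
        rintro f (hf | hf) l (hl | hl) -
        · exact ψ.chain.total hf hl
        · exact key f hf l hl
        · exact (key l hl f hf).symm
        · exact φ.chain.total hf hl
      inv := fun f hf => hf.elim (ψ.inv f) (φ.inv f)
      h_lt := fun f hf => hf.elim (ψ.h_lt f) (φ.h_lt f) }
  have hmax : χ.max = ψ.max := by
    refine le_antisymm ?_ (χ.le_max (Or.inl ψ.max_mem))
    rcases χ.max_mem with hm | hm
    · exact ψ.le_max hm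
    · exact (φ.le_max hm).trans h.1
  have h1 : χ ≤ ψ := le_of_subset_of_max_eq (fun f hf => Or.inl hf) hmax
  have h2 : φ ≤ χ := le_of_subset_of_lt (fun f hf => Or.inr hf)
    (fun l hl hl' => hl.elim (fun hl => h.2 l hl hl') (fun hl => (hl' hl).elim))
  exact Relation.ReflTransGen.trans h1 h2

theorem le_iff_below {φ ψ : Flag S} : φ ≤ ψ ↔ φ.Below ψ := ⟨below_of_le, Below.le⟩

theorem isPartialOrder : IsPartialOrder (Flag S) (fun φ ψ => φ ≤ ψ) where
  refl φ := (Below.refl φ).le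
  trans _ _ _ h₁ h₂ := ((below_of_le h₁).trans (below_of_le h₂)).le
  antisymm _ _ h₁ h₂ := (below_of_le h₁).antisymm (below_of_le h₂)

theorem below_mul_left (φ ψ : Flag S) : φ.Below (φ * ψ) := by
  refine ⟨max_mul φ ψ ▸ le_sup_left, fun l hl hl' => ?_⟩
  rcases mem_mul.1 hl with h | h | h | h
  · exact (hl' h.1).elim
  · exact (hl' h.1).elim
  · exact h.2
  · refine lt_of_le_of_ne (h ▸ le_sup_left) fun he => hl' (he ▸ φ.max_mem)

theorem mul_comm' (φ ψ : Flag S) : φ * ψ = ψ * φ := by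
  refine Flag.ext (Set.ext fun f => ?_)
  rw [mem_mul, mem_mul, sup_comm]
  tauto

theorem Below.mul {φ ψ χ : Flag S} (h₁ : φ.Below χ) (h₂ : ψ.Below χ) : (φ * ψ).Below χ := by
  refine ⟨max_mul φ ψ ▸ sup_le h₁.1 h₂.1, fun l hl hl' => ?_⟩
  rw [mem_mul] at hl'
  push Not at hl'
  rw [max_mul]
  -- A member of `φ` outside the product is not in `ψ`, hence exceeds `ψ.max`, which would put it
  -- into the product after all.
  have hφ : l ∉ φ.carrier := fun h => hl'.2.1 h (h₂.2 l hl (hl'.1 h))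
  have hψ : l ∉ ψ.carrier := fun h => hl'.2.2.1 h (h₁.2 l hl hφ)
  exact lt_of_le_of_ne (sup_le (h₁.2 l hl hφ).le (h₂.2 l hl hψ).le) (Ne.symm hl'.2.2.2)

theorem isLUB_mul (φ ψ : Flag S) : IsLUB {φ, ψ} (φ * ψ) := by
  constructor
  · rintro χ (rfl | rfl)
    · exact (below_mul_left _ _).le
    · rw [mul_comm']
      exact (below_mul_left _ _).le
  · intro χ hχ
    exact ((below_of_le (hχ (Or.inl rfl))).mul (below_of_le (hχ (Or.inr rfl)))).le

theorem below_mul_right (φ ψ : Flag S) : ψ.Below (φ * ψ) :=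
  mul_comm' ψ φ ▸ below_mul_left ψ φ

theorem mul_self (φ : Flag S) : φ * φ = φ :=
  ((Below.refl φ).mul (Below.refl φ)).antisymm (below_mul_left φ φ)

theorem mul_assoc' (φ ψ χ : Flag S) : φ * ψ * χ = φ * (ψ * χ) := by
  refine Below.antisymm (Below.mul (Below.mul ?_ ?_) ?_) (Below.mul ?_ (Below.mul ?_ ?_))
  · exact below_mul_left _ _
  · exact (below_mul_left _ _).trans (below_mul_right _ _)
  · exact (below_mul_right _ _).trans (below_mul_right _ _)
  · exact (below_mul_left _ _).trans (below_mul_left _ _)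
  · exact (below_mul_right _ _).trans (below_mul_left _ _)
  · exact below_mul_right _ _

end Flag

/-! ### Nonnegative invariant operators without trace normalization. -/

/-- Invariant `Q`-symmetric operators with nonnegative spectrum. -/
structure IsPositive (S : InvariantData g) (T : Module.End ℝ g) : Prop where
  symm : ∀ X Y, S.Q (T X) Y = S.Q X (T Y)
  nonneg : ∀ X, 0 ≤ S.Q (T X) X
  comm : ∀ a ∈ S.A, ∀ X, T (a X) = a (T X)

theorem isState_iff {T : Module.End ℝ g} :
    S.IsState T ↔ S.IsPositive T ∧ LinearMap.trace ℝ g T = 1 :=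
  ⟨fun h => ⟨⟨h.1, h.2.1, h.2.2.2⟩, h.2.2.1⟩, fun h => ⟨h.1.1, h.1.2, h.2, h.1.3⟩⟩

theorem Q_self_eq_zero {X : g} (h : S.Q X X = 0) : X = 0 := by
  by_contra h0
  exact (S.pos X h0).ne' h

theorem Q_self_nonneg (X : g) : 0 ≤ S.Q X X := by
  rcases eq_or_ne X 0 with rfl | h
  · simp
  · exact (S.pos X h).le

theorem Q_ad_skew (X Y Z : g) : S.Q ⁅X, Y⁆ Z = - S.Q Y ⁅X, Z⁆ := by
  rw [← lie_skew, map_neg, LinearMap.neg_apply, S.invariant]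

namespace IsPositive

variable {T T' : Module.End ℝ g}

theorem zero : S.IsPositive 0 := ⟨by simp, by simp, by simp⟩

theorem add (h : S.IsPositive T) (h' : S.IsPositive T') : S.IsPositive (T + T') where
  symm X Y := by simp [h.symm, h'.symm]
  nonneg X := by simpa using add_nonneg (h.nonneg X) (h'.nonneg X)
  comm a ha X := by simp [h.comm a ha, h'.comm a ha]

theorem smul (h : S.IsPositive T) {c : ℝ} (hc : 0 ≤ c) : S.IsPositive (c • T) where
  symm X Y := by simp [h.symm]
  nonneg X := by simpa using mul_nonneg hc (h.nonneg X)
  comm a ha X := by simp [h.comm a ha]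

theorem sum {ι : Type*} {s : Finset ι} {F : ι → Module.End ℝ g}
    (h : ∀ i ∈ s, S.IsPositive (F i)) : S.IsPositive (∑ i ∈ s, F i) :=
  Finset.sum_induction F S.IsPositive (fun _ _ => add) zero h

theorem eigenvalue_nonneg (h : S.IsPositive T) {X : g} {r : ℝ} (hX : T X = r • X) (h0 : X ≠ 0) :
    0 ≤ r := by
  have h1 := h.nonneg X
  rw [hX, map_smul, LinearMap.smul_apply, smul_eq_mul] at h1
  exact nonneg_of_mul_nonneg_left h1 (S.pos X h0)

end IsPositive

/-! ### The filtration by eigenvalues -/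

theorem filt_mono (T : Module.End ℝ g) : Monotone (filt T) := fun _ _ hab =>
  Submodule.span_mono fun _ ⟨r, hr, h⟩ => ⟨r, hr.trans hab, h⟩

theorem mem_filt {T : Module.End ℝ g} {X : g} {r a : ℝ} (h : T X = r • X) (hr : r ≤ a) :
    X ∈ filt T a :=
  Submodule.subset_span ⟨r, hr, h⟩

theorem ker_le_filt (T : Module.End ℝ g) {a : ℝ} (ha : 0 ≤ a) : LinearMap.ker T ≤ filt T a :=
  fun X hX => mem_filt (r := 0) (by simpa using hX) ha

theorem IsPositive.filt_of_neg {T : Module.End ℝ g} (h : S.IsPositive T) {a : ℝ} (ha : a < 0) :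
    filt T a = ⊥ := by
  refine (Submodule.span_eq_bot).2 ?_
  rintro X ⟨r, hr, hX⟩
  by_contra h0
  linarith [h.eigenvalue_nonneg hX h0]

theorem IsPositive.filt_zero {T : Module.End ℝ g} (h : S.IsPositive T) :
    filt T 0 = LinearMap.ker T := by
  refine le_antisymm (Submodule.span_le.2 ?_) (ker_le_filt T le_rfl)
  rintro X ⟨r, hr, hX⟩
  by_cases h0 : X = 0
  · simp [h0]
  · have : r = 0 := le_antisymm hr (h.eigenvalue_nonneg hX h0)
    simpa [this] using hX

theorem filt_smul (T : Module.End ℝ g) {c : ℝ} (hc : 0 < c) (a : ℝ) :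
    filt (c • T) a = filt T (c⁻¹ * a) := by
  unfold filt
  congr 1
  ext X
  constructor
  · rintro ⟨r, hr, hX⟩
    refine ⟨c⁻¹ * r, by gcongr, ?_⟩
    rw [mul_smul, ← hX, LinearMap.smul_apply, inv_smul_smul₀ hc.ne']
  · rintro ⟨r, hr, hX⟩
    refine ⟨c * r, ?_, by rw [LinearMap.smul_apply, hX, mul_smul]⟩
    rwa [← div_eq_inv_mul, le_div_iff₀' hc] at hr

theorem filt_zero_operator {a : ℝ} (ha : 0 ≤ a) : filt (0 : Module.End ℝ g) a = ⊤ :=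
  top_le_iff.1 fun _ _ => mem_filt (r := 0) (by simp) ha

theorem Q_apply_eq_zero {T : Module.End ℝ g} {f : LieSubalgebra ℝ g}
    (hT : ∀ X Y, S.Q (T X) Y = S.Q X (T Y))
    (hf : f.toSubmodule ≤ LinearMap.ker T) {X Y : g} (hY : Y ∈ f) : S.Q Y (T X) = 0 := by
  rw [← hT, LinearMap.mem_ker.1 (hf hY)]
  simp

section FiniteDimensional

variable [FiniteDimensional ℝ g]

/-- There are finitely many eigenvalues, so the filtration is a right-continuous step function; this
makes infima of levels attained. -/
theorem exists_filt_right_constant (T : Module.End ℝ g) (a : ℝ) :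
    ∃ b, a < b ∧ ∀ c < b, filt T c ≤ filt T a := by
  have hfin : {r | T.HasEigenvalue r ∧ a < r}.Finite :=
    T.finite_hasEigenvalue.subset fun _ h => h.1
  obtain ⟨b, hab, hb⟩ : ∃ b, a < b ∧ ∀ r, T.HasEigenvalue r → a < r → b ≤ r := by
    rcases Set.eq_empty_or_nonempty {r | T.HasEigenvalue r ∧ a < r} with he | hne
    · exact ⟨a + 1, by linarith, fun r h1 h2 => (Set.eq_empty_iff_forall_notMem.1 he r ⟨h1, h2⟩).elim⟩
    · obtain ⟨b, hb, hmin⟩ := Set.exists_min_image _ id hfin hne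
      exact ⟨b, hb.2, fun r h1 h2 => hmin r ⟨h1, h2⟩⟩
  refine ⟨b, hab, fun c hc => Submodule.span_le.2 ?_⟩
  rintro X ⟨r, hr, hX⟩
  by_cases h0 : X = 0
  · simp [h0]
  · refine mem_filt hX (not_lt.1 fun h => ?_)
    have := hb r (Module.End.hasEigenvalue_of_hasEigenvector
      ⟨Module.End.mem_eigenspace_iff.2 hX, h0⟩) h
    linarith

theorem exists_orthonormal_eigenbasis {T : Module.End ℝ g}
    (hT : ∀ X Y, S.Q (T X) Y = S.Q X (T Y)) :
    ∃ (b : Module.Basis (Fin (Module.finrank ℝ g)) ℝ g) (r : Fin (Module.finrank ℝ g) → ℝ),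
      (∀ i, T (b i) = r i • b i) ∧ ∀ i j, S.Q (b i) (b j) = if i = j then 1 else 0 := by
  -- `Q` serves as a local inner product, to which the spectral theorem applies.
  let core : InnerProductSpace.Core ℝ g :=
    { inner := fun X Y => S.Q X Y
      conj_inner_symm := fun X Y => S.symm Y X
      re_inner_nonneg := fun X => Q_self_nonneg X
      add_left := fun X Y Z => by simp
      smul_left := fun X Y r => by simp
      definite := fun X h => Q_self_eq_zero h }
  let _ : NormedAddCommGroup g := core.toNormedAddCommGroup
  let _ : InnerProductSpace ℝ g := InnerProductSpace.ofCore core.toCore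
  have hs : LinearMap.IsSymmetric T := hT
  refine ⟨(hs.eigenvectorBasis rfl).toBasis, hs.eigenvalues rfl, fun i => ?_, fun i j => ?_⟩
  · rw [OrthonormalBasis.coe_toBasis]
    exact hs.apply_eigenvectorBasis rfl i
  · have := orthonormal_iff_ite.1 (hs.eigenvectorBasis rfl).orthonormal i j
    rw [OrthonormalBasis.coe_toBasis]
    exact this

theorem nonneg_of_eigenvalues_nonneg {T : Module.End ℝ g}
    (hT : ∀ X Y, S.Q (T X) Y = S.Q X (T Y)) (h : ∀ X (r : ℝ), T X = r • X → X ≠ 0 → 0 ≤ r) (X : g) :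
    0 ≤ S.Q (T X) X := by
  obtain ⟨b, r, hb, hQ⟩ := exists_orthonormal_eigenbasis hT
  have : S.Q (T X) X = ∑ i, r i * (b.repr X i) ^ 2 := by
    conv_lhs => rw [← b.sum_repr X]
    simp only [map_sum, map_smul, hb, LinearMap.sum_apply, LinearMap.smul_apply, hQ, smul_eq_mul]
    simp
    exact Finset.sum_congr rfl fun i _ => by ring
  rw [this]
  exact Finset.sum_nonneg fun i _ => mul_nonneg (h (b i) (r i) (hb i) (b.ne_zero i)) (sq_nonneg _)

theorem eigenvectors_induction {T : Module.End ℝ g} (hT : ∀ X Y, S.Q (T X) Y = S.Q X (T Y))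
    {p : Submodule ℝ g} (h : ∀ X (r : ℝ), T X = r • X → X ∈ p) : p = ⊤ := by
  obtain ⟨b, r, hb, -⟩ := exists_orthonormal_eigenbasis hT
  rw [← top_le_iff, ← b.span_eq, Submodule.span_le]
  rintro _ ⟨i, rfl⟩
  exact h _ _ (hb i)

theorem IsPositive.trace_nonneg {T : Module.End ℝ g} (hT : S.IsPositive T) :
    0 ≤ LinearMap.trace ℝ g T ∧ (LinearMap.trace ℝ g T = 0 → T = 0) := by
  obtain ⟨b, r, hb, -⟩ := exists_orthonormal_eigenbasis hT.symm
  have htr : LinearMap.trace ℝ g T = ∑ i, r i := by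
    rw [LinearMap.trace_eq_matrix_trace ℝ b, Matrix.trace]
    exact Finset.sum_congr rfl fun i _ => by simp [LinearMap.toMatrix_apply, hb]
  have hr : ∀ i ∈ Finset.univ, 0 ≤ r i := fun i _ => hT.eigenvalue_nonneg (hb i) (b.ne_zero i)
  refine ⟨htr ▸ Finset.sum_nonneg hr, fun h0 => b.ext fun i => ?_⟩
  rw [htr, Finset.sum_eq_zero_iff_of_nonneg hr] at h0
  simp [hb, h0 i (Finset.mem_univ i)]

theorem exists_filt_eq_top {T : Module.End ℝ g} (hT : ∀ X Y, S.Q (T X) Y = S.Q X (T Y)) :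
    ∃ a, 0 ≤ a ∧ filt T a = ⊤ := by
  obtain ⟨b, r, hb, -⟩ := exists_orthonormal_eigenbasis hT
  refine ⟨∑ i, |r i|, Finset.sum_nonneg fun _ _ => abs_nonneg _, ?_⟩
  rw [← top_le_iff, ← b.span_eq, Submodule.span_le]
  rintro _ ⟨i, rfl⟩
  exact mem_filt (hb i) ((le_abs_self _).trans
    (Finset.single_le_sum (f := fun i => |r i|) (fun _ _ => abs_nonneg _) (Finset.mem_univ i)))

/-- The filtration attains the level at which it first contains a given subspace. -/
theorem exists_least_filt {T : Module.End ℝ g} (hT : ∀ X Y, S.Q (T X) Y = S.Q X (T Y))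
    (p : Submodule ℝ g) :
    ∃ l, 0 ≤ l ∧ p ≤ filt T l ∧ ∀ a, 0 ≤ a → a < l → ¬ p ≤ filt T a := by
  obtain ⟨a₀, ha₀, htop⟩ := exists_filt_eq_top hT
  let s : Set ℝ := {a | 0 ≤ a ∧ p ≤ filt T a}
  have hne : s.Nonempty := ⟨a₀, ha₀, htop ▸ le_top⟩
  have hbd : BddBelow s := ⟨0, fun a ha => ha.1⟩
  refine ⟨sInf s, le_csInf hne fun a ha => ha.1, ?_, fun a ha hlt hp => ?_⟩
  · obtain ⟨b, hab, hb⟩ := exists_filt_right_constant T (sInf s)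
    obtain ⟨c, hc, hcb⟩ := exists_lt_of_csInf_lt hne hab
    exact hc.2.trans (hb c hcb)
  · exact hlt.not_ge (csInf_le hbd ⟨ha, hp⟩)

/-- An operator commutes with the operators `ad X` that preserve its filtration. -/
theorem commute_ad_of_filt {T : Module.End ℝ g} (hT : ∀ X Y, S.Q (T X) Y = S.Q X (T Y)) {X : g}
    (hX : ∀ a, ∀ Y ∈ filt T a, ⁅X, Y⁆ ∈ filt T a) (Y : g) : T ⁅X, Y⁆ = ⁅X, T Y⁆ := by
  have hortho : ∀ {U V : g} {r s : ℝ}, T U = r • U → T V = s • V → r ≠ s → S.Q U V = 0 := by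
    intro U V r s hU hV hrs
    have h1 := hT U V
    rw [hU, hV, map_smul, map_smul, LinearMap.smul_apply, smul_eq_mul, smul_eq_mul] at h1
    have h2 : (r - s) * S.Q U V = 0 := by linarith
    exact (mul_eq_zero.1 h2).resolve_left (sub_ne_zero.2 hrs)
  have key : LinearMap.ker (T ∘ₗ (LieAlgebra.ad ℝ g X : Module.End ℝ g) -
      (LieAlgebra.ad ℝ g X : Module.End ℝ g) ∘ₗ T) = ⊤ := by
    refine eigenvectors_induction hT fun Y r hY => ?_
    simp only [LinearMap.mem_ker, LinearMap.sub_apply, LinearMap.comp_apply, LieAlgebra.ad_apply,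
      hY, lie_smul, sub_eq_zero]
    -- Modulo strictly smaller eigenvalues, an element of `filt T r` is an eigenvector for `r`.
    have hsplit : ∀ Z ∈ filt T r, ∃ U, T U = r • U ∧
        Z - U ∈ Submodule.span ℝ {Z | ∃ s < r, T Z = s • Z} := by
      intro Z hZ
      refine Submodule.span_induction (p := fun Z _ => ∃ U, T U = r • U ∧
        Z - U ∈ Submodule.span ℝ {Z | ∃ s < r, T Z = s • Z}) ?_ ⟨0, by simp⟩ ?_ ?_ hZ
      · rintro V ⟨s, hs, hV⟩
        rcases hs.lt_or_eq with h | rfl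
        · refine ⟨0, by simp, ?_⟩
          rw [sub_zero]
          exact Submodule.subset_span ⟨s, h, hV⟩
        · exact ⟨V, hV, by simp⟩
      · rintro Z Z' - - ⟨U, hU, hZ⟩ ⟨U', hU', hZ'⟩
        refine ⟨U + U', by rw [map_add, hU, hU', smul_add], ?_⟩
        rw [add_sub_add_comm]
        exact add_mem hZ hZ'
      · rintro c Z - ⟨U, hU, hZ⟩
        refine ⟨c • U, by rw [map_smul, hU, smul_comm], ?_⟩
        rw [← smul_sub]
        exact Submodule.smul_mem _ _ hZ
    obtain ⟨U, hU, hV⟩ := hsplit _ (hX r Y (mem_filt hY le_rfl))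
    -- Since `ad X` is skew and preserves the lower levels, to which `Y` is orthogonal, `⁅X, Y⁆` is
    -- orthogonal to them too; the lower-order remainder is thus orthogonal to itself.
    have hperp : ∀ V ∈ Submodule.span ℝ {Z | ∃ s < r, T Z = s • Z}, S.Q (⁅X, Y⁆ - U) V = 0 := by
      intro V hV
      have : Submodule.span ℝ {Z | ∃ s < r, T Z = s • Z} ≤ LinearMap.ker (S.Q (⁅X, Y⁆ - U)) := by
        refine Submodule.span_le.2 ?_
        rintro Z ⟨s, hs, hZ⟩
        rw [SetLike.mem_coe, LinearMap.mem_ker, map_sub, LinearMap.sub_apply,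
          hortho hU hZ hs.ne', sub_zero, Q_ad_skew, neg_eq_zero]
        have hle : filt T s ≤ LinearMap.ker (S.Q Y) := by
          refine Submodule.span_le.2 ?_
          rintro Z' ⟨s', hs', hZ'⟩
          exact hortho hY hZ' (hs'.trans_lt hs).ne'
        exact hle (hX s Z (mem_filt hZ le_rfl))
      exact this hV
    have : ⁅X, Y⁆ = U := sub_eq_zero.1 (Q_self_eq_zero (hperp _ hV))
    rw [this, hU]
  have : Y ∈ LinearMap.ker (T ∘ₗ (LieAlgebra.ad ℝ g X : Module.End ℝ g) -
      (LieAlgebra.ad ℝ g X : Module.End ℝ g) ∘ₗ T) := key ▸ Submodule.mem_top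
  simpa [sub_eq_zero] using this

/-! ### Orthogonal projectors -/

/-- The orthogonal projector onto the orthogonal complement of `f`. -/
def coProj (S : InvariantData g) (f : LieSubalgebra ℝ g) : Module.End ℝ g := 1 - S.orthProj f

variable {f : LieSubalgebra ℝ g}

theorem sub_coProj_mem (X : g) : X - S.coProj f X ∈ f := by
  have : X - S.coProj f X = S.orthProj f X := by simp [coProj]
  rw [this]
  exact Submodule.projection_apply_mem _ X

theorem Q_coProj {X Y : g} (hY : Y ∈ f) : S.Q Y (S.coProj f X) = 0 := by
  have : S.coProj f X ∈ S.Q.orthogonal f.toSubmodule :=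
    Submodule.sub_projection_mem (S.isCompl_orthogonal f.toSubmodule) X
  exact LinearMap.BilinForm.mem_orthogonal_iff.1 this Y hY

theorem coProj_unique {X V : g} (h : X - V ∈ f) (hV : ∀ Y ∈ f, S.Q Y V = 0) :
    S.coProj f X = V := by
  have h1 : S.coProj f X - V ∈ f := by
    have := sub_mem h (sub_coProj_mem (S := S) (f := f) X)
    rwa [sub_sub_sub_cancel_left] at this
  refine sub_eq_zero.1 (Q_self_eq_zero (S := S) ?_)
  have h2 := hV _ h1
  have h3 := Q_coProj (S := S) (X := X) h1
  rw [map_sub (S.Q (S.coProj f X - V)), h2, h3, sub_zero]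

theorem coProj_of_mem {X : g} (h : X ∈ f) : S.coProj f X = 0 :=
  coProj_unique (by simpa using h) (by simp)

theorem coProj_of_perp {X : g} (h : ∀ Y ∈ f, S.Q Y X = 0) : S.coProj f X = X :=
  coProj_unique (by simp) h

theorem Q_coProj_left (X Y : g) : S.Q (S.coProj f X) Y = S.Q (S.coProj f X) (S.coProj f Y) := by
  have h := Q_coProj (S := S) (X := X) (sub_coProj_mem (S := S) (f := f) Y)
  rw [S.symm, map_sub, sub_eq_zero] at h
  exact h

theorem isPositive_coProj (hf : S.IsInvariant f) : S.IsPositive (S.coProj f) where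
  symm X Y := by rw [Q_coProj_left, S.symm X, Q_coProj_left Y, S.symm]
  nonneg X := by rw [Q_coProj_left]; exact Q_self_nonneg _
  comm a ha X := by
    refine coProj_unique ?_ fun Y hY => ?_
    · rw [← map_sub]
      exact hf a ha _ (sub_coProj_mem X)
    · have h1 := S.map_Q a ha (a⁻¹ Y) (S.coProj f X)
      have h2 : a (a⁻¹ Y) = Y := LinearEquiv.apply_symm_apply a Y
      rw [h2] at h1
      rw [h1]
      exact Q_coProj (hf _ (inv_mem ha) _ hY)

theorem coProj_ker : LinearMap.ker (S.coProj f) = f.toSubmodule := by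
  refine le_antisymm (fun X hX => ?_) fun X hX => coProj_of_mem hX
  have h := sub_coProj_mem (S := S) (f := f) X
  rw [LinearMap.mem_ker] at hX
  rwa [hX, sub_zero] at h

theorem trace_coProj : LinearMap.trace ℝ g (S.coProj f) =
    Module.finrank ℝ (g ⧸ f.toSubmodule) := by
  have hp : LinearMap.IsProj f.toSubmodule (S.orthProj f) :=
    ⟨fun X => Submodule.projection_apply_mem _ X,
      fun X hX => Submodule.projection_apply_of_mem_left _ hX⟩
  rw [coProj, map_sub, hp.trace, LinearMap.trace_one]
  have := Submodule.finrank_quotient_add_finrank f.toSubmodule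
  rw [← this]
  push_cast
  ring

/-! ### Adding and removing a multiple of a complementary projector. -/

section Shift

variable {T : Module.End ℝ g}

theorem apply_coProj (hf : f.toSubmodule ≤ LinearMap.ker T) (X : g) : T (S.coProj f X) = T X := by
  have := hf (sub_coProj_mem (S := S) X)
  rw [LinearMap.mem_ker, map_sub, sub_eq_zero] at this
  exact this.symm

theorem coProj_apply (hT : ∀ X Y, S.Q (T X) Y = S.Q X (T Y))
    (hf : f.toSubmodule ≤ LinearMap.ker T) (X : g) : S.coProj f (T X) = T X :=
  coProj_of_perp fun _ => Q_apply_eq_zero hT hf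

/-- The two components of an eigenvector of `T + c (1 - 1_f)`. -/
theorem eigenvector_add_coProj (hT : ∀ X Y, S.Q (T X) Y = S.Q X (T Y))
    (hf : f.toSubmodule ≤ LinearMap.ker T) {c r : ℝ} {X : g}
    (hX : (T + c • S.coProj f) X = r • X) :
    r • (X - S.coProj f X) = 0 ∧ T (S.coProj f X) = (r - c) • S.coProj f X := by
  rw [LinearMap.add_apply, LinearMap.smul_apply] at hX
  have h1 : S.coProj f ((T X) + c • S.coProj f X) = T X + c • S.coProj f X := by
    rw [map_add, map_smul, coProj_apply hT hf, coProj_of_perp (X := S.coProj f X)]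
    exact fun Y hY => Q_coProj hY
  rw [hX, map_smul] at h1
  refine ⟨by rw [smul_sub, h1, sub_self], ?_⟩
  rw [apply_coProj hf, sub_smul, h1, ← hX, add_sub_cancel_right]

/-- On `fᗮ` all eigenvalues are at least `c`, and on `f` the operator vanishes. -/
theorem filt_add_coProj_of_lt (hT : S.IsPositive T) (hf : f.toSubmodule ≤ LinearMap.ker T)
    {a c : ℝ} (ha : 0 ≤ a) (hac : a < c) : filt (T + c • S.coProj f) a = f.toSubmodule := by
  refine le_antisymm (Submodule.span_le.2 ?_) fun X hX => ?_
  · rintro X ⟨r, hr, hX⟩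
    have h := (eigenvector_add_coProj hT.symm hf hX).2
    have h0 : S.coProj f X = 0 := by
      by_contra h0
      linarith [hT.eigenvalue_nonneg h h0]
    rw [SetLike.mem_coe, ← coProj_ker (S := S)]
    exact h0
  · refine mem_filt (r := 0) ?_ ha
    simp [coProj_of_mem hX, LinearMap.mem_ker.1 (hf hX)]

theorem filt_add_coProj_of_le (hT : S.IsPositive T) (hf : f.toSubmodule ≤ LinearMap.ker T)
    {a c : ℝ} (hc : 0 ≤ c) (hca : c ≤ a) : filt (T + c • S.coProj f) a = filt T (a - c) := by
  have hker : ∀ X, (X - S.coProj f X) ∈ LinearMap.ker T := fun X => hf (sub_coProj_mem X)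
  refine le_antisymm (Submodule.span_le.2 ?_) (Submodule.span_le.2 ?_)
  · rintro X ⟨r, hr, hX⟩
    have h := (eigenvector_add_coProj hT.symm hf hX).2
    rw [SetLike.mem_coe, ← sub_add_cancel X (S.coProj f X)]
    exact add_mem (ker_le_filt T (by linarith) (hker X)) (mem_filt h (by linarith))
  · rintro X ⟨r, hr, hX⟩
    have h1 : T (S.coProj f X) = r • S.coProj f X := by
      have := coProj_apply hT.symm hf X
      rw [hX, map_smul] at this
      rw [apply_coProj hf, hX, this]
    rw [SetLike.mem_coe, ← sub_add_cancel X (S.coProj f X)]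
    refine add_mem (mem_filt (r := 0) ?_ (hc.trans hca)) (mem_filt (r := r + c) ?_ (by linarith))
    · have h2 := coProj_of_mem (S := S) (sub_coProj_mem (S := S) (f := f) X)
      have h3 := LinearMap.mem_ker.1 (hker X)
      simp only [LinearMap.add_apply, LinearMap.smul_apply, h2, h3]
      simp
    · have h2 : S.coProj f (S.coProj f X) = S.coProj f X :=
        coProj_of_perp fun Y hY => Q_coProj hY
      rw [LinearMap.add_apply, LinearMap.smul_apply, h1, h2, add_smul]

/-- Subtracting the smallest positive eigenvalue on the complement of the kernel. -/
theorem exists_peel (hT : S.IsPositive T) (hf : f.toSubmodule = LinearMap.ker T)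
    (hinv : S.IsInvariant f) (h0 : T ≠ 0) :
    ∃ (T' : Module.End ℝ g) (c : ℝ), 0 < c ∧ S.IsPositive T' ∧
      LinearMap.ker T < LinearMap.ker T' ∧ T = T' + c • S.coProj f := by
  have hne : {r | T.HasEigenvalue r ∧ r ≠ 0}.Nonempty := by
    by_contra hemp
    refine h0 (LinearMap.ker_eq_top.1 (eigenvectors_induction hT.symm fun X r hX => ?_))
    by_cases hX0 : X = 0
    · simp [hX0]
    · by_cases hr : r = 0
      · simpa [hr] using hX
      · exact (hemp ⟨r, Module.End.hasEigenvalue_of_hasEigenvector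
          ⟨Module.End.mem_eigenspace_iff.2 hX, hX0⟩, hr⟩).elim
  obtain ⟨c, ⟨hc, hc0⟩, hmin⟩ := Set.exists_min_image {r | T.HasEigenvalue r ∧ r ≠ 0} id
    (T.finite_hasEigenvalue.subset fun _ h => h.1) hne
  obtain ⟨Z, hZ⟩ := hc.exists_hasEigenvector
  have hTZ := hZ.apply_eq_smul
  have hcpos : 0 < c := lt_of_le_of_ne (hT.eigenvalue_nonneg hTZ hZ.2) (Ne.symm hc0)
  have hsymm : ∀ X Y, S.Q ((T + (-c) • S.coProj f) X) Y = S.Q X ((T + (-c) • S.coProj f) Y) := by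
    intro X Y
    simp [hT.symm, (isPositive_coProj hinv).symm]
  have hpos : S.IsPositive (T + (-c) • S.coProj f) := by
    refine ⟨hsymm, nonneg_of_eigenvalues_nonneg hsymm fun X r hX hX0 => ?_, fun a ha X => ?_⟩
    · obtain ⟨h1, h2⟩ := eigenvector_add_coProj hT.symm hf.le hX
      by_cases hX' : S.coProj f X = 0
      · rw [hX', sub_zero] at h1
        exact ((smul_eq_zero.1 h1).resolve_right hX0).ge
      -- A nonzero vector orthogonal to `f = ker T` cannot lie in `ker T`; so `r + c` is a nonzero
      -- eigenvalue of `T`, at least `c` by minimality.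
      · have hr : r - -c ≠ 0 := by
          intro hr
          rw [hr, zero_smul, ← LinearMap.mem_ker, ← hf] at h2
          exact hX' (by rw [← coProj_of_mem (S := S) h2, coProj_of_perp fun Y hY => Q_coProj hY])
        have := hmin _ ⟨Module.End.hasEigenvalue_of_hasEigenvector
          ⟨Module.End.mem_eigenspace_iff.2 h2, hX'⟩, hr⟩
        simp only [id] at this
        linarith
    · simp [hT.comm a ha, (isPositive_coProj hinv).comm a ha]
  refine ⟨_, c, hcpos, hpos, lt_of_le_of_ne (fun X hX => ?_) fun he => ?_, by simp⟩
  · have hX' : X ∈ f := by rw [← hf] at hX; exact hX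
    simp [LinearMap.mem_ker.1 hX, coProj_of_mem hX']
  -- The kernel grows strictly: the eigenvector `Z` for `c` is orthogonal to `f` and is killed after
  -- the subtraction.
  · have hcoZ : S.coProj f Z = Z := coProj_of_perp fun Y hY => by
      have := Q_apply_eq_zero (X := Z) hT.symm hf.le hY
      rw [hTZ, map_smul, smul_eq_mul] at this
      exact (mul_eq_zero.1 this).resolve_left hc0
    have hZ' : Z ∈ LinearMap.ker T := by
      rw [he]
      simp [hcoZ, hTZ]
    rw [LinearMap.mem_ker, hTZ] at hZ'
    exact (smul_ne_zero hc0 hZ.2) hZ'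

end Shift

end FiniteDimensional

/-! ### Axioms for cell conditions, and the two instances. -/

/-- A condition on a subalgebra and a filtration with nonnegative indices which has the stability
properties needed to intersect butterflies with cells defined by this condition. -/
structure CellRule (g : Type*) [LieRing g] [LieAlgebra ℝ g] where
  rule : LieSubalgebra ℝ g → (ℝ → Submodule ℝ g) → Prop
  congr : ∀ {f G G'}, (∀ a, 0 ≤ a → G a = G' a) → rule f G → rule f G'
  scale : ∀ {f G c}, 0 < c → rule f G → rule f (fun a => G (c * a))
  -- Covers the filtrations of the zero operator and of `χ̄^f`.
  const : ∀ {f : LieSubalgebra ℝ g} {G}, Monotone G →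
    (∀ a, 0 ≤ a → G a = f.toSubmodule ∨ G a = ⊤) → rule f G
  -- Used to pass from two flags to their product.
  join : ∀ {f k : LieSubalgebra ℝ g} {G : ℝ → Submodule ℝ g} {l m : ℝ}, Monotone G → l ≤ m →
    f.toSubmodule ≤ G l → k.toSubmodule ≤ G m → rule f (fun a => G (l + a)) →
    rule k (fun a => G (m + a)) →
    (f ⊔ k).toSubmodule ≤ G m ∧ rule (f ⊔ k) (fun a => G (m + a))
  -- Used to pass from a product back to a factor: between the two levels the filtration consists of
  -- subalgebras of `k`.
  descend : ∀ {f k : LieSubalgebra ℝ g} {G : ℝ → Submodule ℝ g} {l m : ℝ}, Monotone G → l ≤ m →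
    f ≤ k → f.toSubmodule ≤ G l → k.toSubmodule ≤ G m →
    (∀ a, l ≤ a → a < m → ∃ q : LieSubalgebra ℝ g, q ≤ k ∧ q.toSubmodule = G a) →
    rule k (fun a => G (m + a)) → rule f (fun a => G (l + a))

/-- The bracket is compatible with the filtration. -/
def filteringRule (g : Type*) [LieRing g] [LieAlgebra ℝ g] : CellRule g where
  rule _ G := ∀ a b, 0 ≤ a → 0 ≤ b → ∀ X ∈ G a, ∀ Y ∈ G b, ⁅X, Y⁆ ∈ G (a + b)
  congr h H a b ha hb := by
    rw [← h a ha, ← h b hb, ← h _ (add_nonneg ha hb)]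
    exact H a b ha hb
  scale {f G c} hc H a b ha hb X hX Y hY := by
    simp only [mul_add]
    exact H _ _ (by positivity) (by positivity) X hX Y hY
  const {f G} hG H a b ha hb X hX Y hY := by
    have hle : ∀ x, 0 ≤ x → f.toSubmodule ≤ G x := fun x hx =>
      (H x hx).elim (fun h => h.ge) (fun h => h ▸ le_top)
    have htop : ∀ {x}, G x = ⊤ → x ≤ a + b → ⁅X, Y⁆ ∈ G (a + b) := fun {x} h hx =>
      hG hx (h ▸ Submodule.mem_top)
    rcases H a ha with h | h
    · rcases H b hb with h' | h'
      · rw [h] at hX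
        rw [h'] at hY
        exact hle _ (add_nonneg ha hb) (f.lie_mem hX hY)
      · exact htop h' (by linarith)
    · exact htop h (by linarith)
  join {f k G l m} hG hlm hf hk _ Hk := by
    refine ⟨?_, Hk⟩
    -- At index zero the rule for `k` says that `G m` is itself a subalgebra.
    let q : LieSubalgebra ℝ g :=
      { G m with
        lie_mem' := fun {X Y} hX hY => by
          have := Hk 0 0 le_rfl le_rfl X (by simpa using hX) Y (by simpa using hY)
          simpa using this }
    have hq : f ⊔ k ≤ q := sup_le (fun X hX => hG hlm (hf hX)) fun X hX => hk hX
    exact fun X hX => hq hX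
  descend {f k G l m} hG hl hfk hf hk hq H := by
    -- With one level below `m`: either both elements lie in one subalgebra of the filtration, or
    -- the first lies in `k ≤ G m` and acts with degree zero beyond `m`.
    have hmix : ∀ a b, l ≤ a → a < m → l ≤ b → ∀ X ∈ G a, ∀ Y ∈ G b, ⁅X, Y⁆ ∈ G (a + b - l) := by
      intro a b ha ham hb X hX Y hY
      by_cases hbm : b < m
      · obtain ⟨q, -, hq⟩ := hq (max a b) (le_max_of_le_left ha) (max_lt ham hbm)
        have hX' : X ∈ q.toSubmodule := hq ▸ hG (le_max_left a b) hX
        have hY' : Y ∈ q.toSubmodule := hq ▸ hG (le_max_right a b) hY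
        have h : ⁅X, Y⁆ ∈ q.toSubmodule := q.lie_mem hX' hY'
        rw [hq] at h
        exact hG (max_le (by linarith) (by linarith)) h
      · obtain ⟨q, hqk, hq⟩ := hq a ha ham
        have hX' : X ∈ q.toSubmodule := hq ▸ hX
        have h := H 0 (b - m) le_rfl (by linarith) X (by simpa using hk (hqk hX')) Y
          (by simpa using hY)
        simp only [zero_add, add_sub_cancel] at h
        exact hG (by linarith) h
    intro a b ha hb X hX Y hY
    by_cases ham : l + a < m
    · exact hG (by linarith) (hmix _ _ (by linarith) ham (by linarith) X hX Y hY)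
    by_cases hbm : l + b < m
    · rw [← lie_skew]
      exact neg_mem (hG (by linarith) (hmix _ _ (by linarith) hbm (by linarith) Y hY X hX))
    · have h := H (l + a - m) (l + b - m) (by linarith) (by linarith) X (by simpa using hX) Y
        (by simpa using hY)
      exact hG (by linarith) h

/-- The filtration is preserved by `ad f`. -/
def adRule (g : Type*) [LieRing g] [LieAlgebra ℝ g] : CellRule g where
  rule f G := ∀ a, 0 ≤ a → ∀ X ∈ f, ∀ Y ∈ G a, ⁅X, Y⁆ ∈ G a
  congr h H a ha := by
    rw [← h a ha]
    exact H a ha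
  scale {f G c} hc H a ha := H _ (by positivity)
  const {f G} hG H a ha X hX Y hY := by
    rcases H a ha with h | h
    · rw [h] at hY ⊢
      exact f.lie_mem hX hY
    · exact h ▸ Submodule.mem_top
  join {f k G l m} hG hlm hf hk Hf Hk := by
    -- By the Jacobi identity, the elements of `G m` whose `ad` preserves all later levels form a
    -- subalgebra.
    let q : LieSubalgebra ℝ g :=
      { carrier := {X | X ∈ G m ∧ ∀ a, 0 ≤ a → ∀ Y ∈ G (m + a), ⁅X, Y⁆ ∈ G (m + a)}
        zero_mem' := ⟨zero_mem _, fun a _ Y _ => by simp⟩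
        add_mem' := fun {X X'} hX hX' => ⟨add_mem hX.1 hX'.1, fun a ha Y hY => by
          rw [add_lie]
          exact add_mem (hX.2 a ha Y hY) (hX'.2 a ha Y hY)⟩
        smul_mem' := fun c X hX => ⟨Submodule.smul_mem _ c hX.1, fun a ha Y hY => by
          rw [smul_lie]
          exact Submodule.smul_mem _ c (hX.2 a ha Y hY)⟩
        lie_mem' := fun {X X'} hX hX' => ⟨by
          simpa using hX.2 0 le_rfl X' (by simpa using hX'.1), fun a ha Y hY => by
          rw [lie_lie]
          exact sub_mem (hX.2 a ha _ (hX'.2 a ha Y hY)) (hX'.2 a ha _ (hX.2 a ha Y hY))⟩ }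
    have hq : f ⊔ k ≤ q := by
      refine sup_le (fun X hX => ⟨hG hlm (hf hX), fun a ha Y hY => ?_⟩)
        fun X hX => ⟨hk hX, fun a ha Y hY => Hk a ha X hX Y hY⟩
      have h := Hf (m + a - l) (by linarith) X hX Y (by simpa using hY)
      simpa using h
    exact ⟨fun X hX => (hq hX).1, fun a ha X hX Y hY => (hq hX).2 a ha Y hY⟩
  descend {f k G l m} hG hl hfk hf hk hq H := by
    intro a ha X hX Y hY
    by_cases ham : l + a < m
    · obtain ⟨q, -, hq⟩ := hq (l + a) (by linarith) ham
      have hX' : X ∈ q.toSubmodule := hq ▸ hG (by linarith) (hf hX)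
      have hY' : Y ∈ q.toSubmodule := hq ▸ hY
      have h : ⁅X, Y⁆ ∈ q.toSubmodule := q.lie_mem hX' hY'
      rwa [hq] at h
    · have h := H (l + a - m) (by linarith) X (hfk hX) Y (by simpa using hY)
      simpa using h

/-- The cells `V f` are cut out by the condition `R`. -/
def IsCellFamily (S : InvariantData g) (R : CellRule g)
    (V : LieSubalgebra ℝ g → Set (Module.End ℝ g)) : Prop :=
  ∀ f, S.h < f → ∀ T, T ∈ V f ↔
    S.IsState T ∧ f.toSubmodule ≤ LinearMap.ker T ∧ R.rule f (filt T)

theorem IsState.ne_zero {T : Module.End ℝ g} (hT : S.IsState T) : T ≠ 0 := by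
  rintro rfl
  simpa using hT.2.2.1

/-- The remaining conditions of `W` are automatic: negative levels vanish, `h < f ≤ ker T`, and
trace one prevents `T = 0`. -/
theorem isCellFamily_cellX : S.IsCellFamily (filteringRule g) S.cellX := by
  intro f hf T
  constructor
  · rintro ⟨⟨hT, hF, -⟩, hker⟩
    exact ⟨hT, hker, fun a b _ _ => hF a b⟩
  · rintro ⟨hT, hker, hF⟩
    have hpos := (isState_iff.1 hT).1
    refine ⟨⟨hT, fun a b X hX Y hY => ?_, ?_, hpos.filt_zero, ?_⟩, hker⟩
    · rcases lt_or_ge a 0 with ha | ha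
      · rw [hpos.filt_of_neg ha, Submodule.mem_bot] at hX
        simp [hX]
      rcases lt_or_ge b 0 with hb | hb
      · rw [hpos.filt_of_neg hb, Submodule.mem_bot] at hY
        simp [hY]
      exact hF a b ha hb X hX Y hY
    · rw [hpos.filt_zero]
      exact lt_of_lt_of_le hf hker
    · exact lt_top_iff_ne_top.2 fun h => hT.ne_zero (LinearMap.ker_eq_top.1 h)

/-- The intrinsic description of a butterfly: up to the level `l` at which it swallows the largest
member of the flag, the filtration of `T` consists of members of the flag, and beyond that level
the condition defining the cells holds. -/
def Layered (R : CellRule g) (φ : Flag S) (T : Module.End ℝ g) : Prop :=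
  ∃ l, 0 ≤ l ∧ φ.max.toSubmodule ≤ filt T l ∧
    (∀ a, 0 ≤ a → a < l → (∃ f ∈ φ.carrier, f.toSubmodule = filt T a) ∧
      ¬ φ.max.toSubmodule ≤ filt T a) ∧
    R.rule φ.max (fun a => filt T (l + a))

variable {R : CellRule g} {φ ψ : Flag S} {T : Module.End ℝ g}

theorem layered_mul_of_le {l m : ℝ} (hlm : l ≤ m) (hl : φ.max.toSubmodule ≤ filt T l)
    (Hl : ∀ a, 0 ≤ a → a < l → ∃ f ∈ φ.carrier, f.toSubmodule = filt T a)
    (hRl : R.rule φ.max (fun a => filt T (l + a))) (hm0 : 0 ≤ m)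
    (hm : ψ.max.toSubmodule ≤ filt T m)
    (Hm : ∀ a, 0 ≤ a → a < m → (∃ f ∈ ψ.carrier, f.toSubmodule = filt T a) ∧
      ¬ ψ.max.toSubmodule ≤ filt T a)
    (hRm : R.rule ψ.max (fun a => filt T (m + a))) : Layered R (φ * ψ) T := by
  obtain ⟨hjoin, hrule⟩ := R.join (filt_mono T) hlm hl hm hRl hRm
  refine ⟨m, hm0, by rwa [Flag.max_mul], fun a ha ham => ⟨?_, fun h => (Hm a ha ham).2 ?_⟩,
    by rwa [Flag.max_mul]⟩
  · obtain ⟨f, hf, hfa⟩ := (Hm a ha ham).1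
    refine ⟨f, Flag.mem_mul.2 ?_, hfa⟩
    -- Below `l` the term belongs to both flags; from `l` on it contains `φ.max`, with equality
    -- giving a common member.
    by_cases hal : a < l
    · obtain ⟨f', hf', hfa'⟩ := Hl a ha hal
      have : f' = f := LieSubalgebra.toSubmodule_injective (hfa'.trans hfa.symm)
      exact Or.inl ⟨this ▸ hf', hf⟩
    · have hle : φ.max ≤ f := fun X hX => by
        have : X ∈ f.toSubmodule := hfa ▸ filt_mono T (not_lt.1 hal) (hl hX)
        exact this
      rcases hle.eq_or_lt with h | h
      · exact Or.inl ⟨h ▸ φ.max_mem, hf⟩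
      · exact Or.inr (Or.inr (Or.inl ⟨hf, h⟩))
  · rw [Flag.max_mul] at h
    exact fun X hX => h ((le_sup_right : ψ.max ≤ φ.max ⊔ ψ.max) hX)

theorem Layered.mul (h : Layered R φ T) (h' : Layered R ψ T) : Layered R (φ * ψ) T := by
  obtain ⟨l, hl0, hl, Hl, hRl⟩ := h
  obtain ⟨m, hm0, hm, Hm, hRm⟩ := h'
  rcases le_total l m with hlm | hlm
  · exact layered_mul_of_le hlm hl (fun a ha hal => (Hl a ha hal).1) hRl hm0 hm Hm hRm
  · rw [Flag.mul_comm']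
    exact layered_mul_of_le hlm hm (fun a ha hal => (Hm a ha hal).1) hRm hl0 hl Hl hRl

/-! ### Butterfly membership read off from the filtration. -/

namespace Flag

/-- The members of a flag other than the largest one. -/
def tail (φ : Flag S) : Finset (LieSubalgebra ℝ g) :=
  (φ.finite.sdiff (t := {φ.max})).toFinset

theorem mem_tail {f : LieSubalgebra ℝ g} : f ∈ φ.tail ↔ f ∈ φ.carrier ∧ f ≠ φ.max := by
  simp [tail]

theorem coe_tail : (φ.tail : Set (LieSubalgebra ℝ g)) = φ.carrier \ {φ.max} := by
  simp [tail]

theorem lt_max_of_mem_tail {f : LieSubalgebra ℝ g} (hf : f ∈ φ.tail) : f < φ.max :=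
  lt_of_le_of_ne (φ.le_max (mem_tail.1 hf).1) (mem_tail.1 hf).2

theorem length_eq_one_iff : φ.length = 1 ↔ φ.tail = ∅ := by
  have h : φ.tail.card + 1 = φ.length := by
    rw [← Set.ncard_coe_finset, coe_tail]
    exact Set.ncard_sdiff_singleton_add_one φ.max_mem φ.finite
  rw [← Finset.card_eq_zero]
  omega

theorem top_mem_iff : ⊤ ∈ φ.carrier ↔ φ.max = ⊤ :=
  ⟨fun h => top_le_iff.1 (φ.le_max h), fun h => h ▸ φ.max_mem⟩

end Flag

theorem rule_smul {f : LieSubalgebra ℝ g} (h : R.rule f (filt T)) {c : ℝ} (hc : 0 ≤ c) :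
    R.rule f (filt (c • T)) := by
  rcases hc.eq_or_lt with rfl | hc
  · rw [zero_smul]
    exact R.const (filt_mono _) fun a ha => Or.inr (filt_zero_operator ha)
  · exact R.congr (fun a _ => (filt_smul T hc a).symm) (R.scale (inv_pos.2 hc) h)

theorem Flag.ne_top_of_mem_tail {f : LieSubalgebra ℝ g} (hf : f ∈ φ.tail) : f ≠ ⊤ :=
  ((Flag.lt_max_of_mem_tail hf).trans_le le_top).ne

theorem convex_isState : Convex ℝ {T : Module.End ℝ g | S.IsState T} := by
  intro T hT T' hT' a b ha hb hab
  rw [Set.mem_ofPred_eq, isState_iff] at hT hT' ⊢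
  refine ⟨(hT.1.smul ha).add (hT'.1.smul hb), ?_⟩
  rw [map_add, map_smul, map_smul, hT.2, hT'.2]
  simpa using hab

variable [FiniteDimensional ℝ g]

/-- For symmetric `T`, commuting with `ad X` amounts to `ad X` preserving the filtration
(`commute_ad_of_filt`). The extra element outside `h` is found in `f`. -/
theorem isCellFamily_cellD : S.IsCellFamily (adRule g) S.cellD := by
  intro f hf T
  constructor
  · rintro ⟨⟨hT, -⟩, hker⟩
    refine ⟨hT, fun X hX => (hker X hX).1, fun a _ X hX Y hY => ?_⟩
    have hle : filt T a ≤ (filt T a).comap (LieAlgebra.ad ℝ g X : Module.End ℝ g) := by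
      refine Submodule.span_le.2 ?_
      rintro Z ⟨r, hr, hZ⟩
      refine mem_filt (r := r) ?_ hr
      rw [LieAlgebra.ad_apply, (hker X hX).2, hZ, lie_smul]
    exact hle hY
  · rintro ⟨hT, hker, hF⟩
    have hpos := (isState_iff.1 hT).1
    have hkill : ∀ X ∈ f, KillsAndCommutes T X := by
      refine fun X hX => ⟨hker hX, fun Y => commute_ad_of_filt hpos.symm (fun a Y hY => ?_) Y⟩
      rcases lt_or_ge a 0 with ha | ha
      · rw [hpos.filt_of_neg ha, Submodule.mem_bot] at hY
        simp [hY]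
      · exact hF a ha X hX Y hY
    obtain ⟨Z, hZ, hZ'⟩ := SetLike.exists_of_lt hf
    exact ⟨⟨hT, fun X hX => hkill X (hf.le hX), Z, hZ', hkill Z hZ⟩, hkill⟩

theorem Layered.of_mul_left (hT : ∀ X Y, S.Q (T X) Y = S.Q X (T Y)) (h : Layered R (φ * ψ) T) :
    Layered R φ T := by
  obtain ⟨m, hm0, hm, Hm, hRm⟩ := h
  obtain ⟨l, hl0, hl, Hl⟩ := exists_least_filt hT φ.max.toSubmodule
  have hle : φ.max ≤ (φ * ψ).max := Flag.max_mul φ ψ ▸ le_sup_left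
  have hlm : l ≤ m := not_lt.1 fun h => Hl m hm0 h fun X hX => hm (hle hX)
  refine ⟨l, hl0, hl, fun a ha hal => ⟨?_, Hl a ha hal⟩,
    R.descend (filt_mono T) hlm hle hl hm (fun a hla ham => ?_) hRm⟩
  · obtain ⟨f, hf, hfa⟩ := (Hm a ha (hal.trans_le hlm)).1
    -- Below the least level containing `φ.max`, the pieces of the product lying above `φ.max` are
    -- excluded.
    have hf' : ¬ φ.max ≤ f := fun h => Hl a ha hal (hfa ▸ h)
    refine ⟨f, ?_, hfa⟩
    rcases Flag.mem_mul.1 hf with h | h | h | h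
    · exact h.1
    · exact h.1
    · exact (hf' h.2.le).elim
    · exact (hf' (h ▸ le_sup_left)).elim
  · obtain ⟨f, hf, hfa⟩ := (Hm a (hl0.trans hla) ham).1
    exact ⟨f, (φ * ψ).le_max hf, hfa⟩

theorem layered_mul_iff (hT : ∀ X Y, S.Q (T X) Y = S.Q X (T Y)) :
    Layered R (φ * ψ) T ↔ Layered R φ T ∧ Layered R ψ T :=
  ⟨fun h => ⟨h.of_mul_left hT, Layered.of_mul_left (ψ := φ) hT (Flag.mul_comm' φ ψ ▸ h)⟩,
    fun h => h.1.mul h.2⟩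

theorem Layered.add_coProj (h : Layered R φ T) (hT : S.IsPositive T) {f : LieSubalgebra ℝ g}
    (hf : f ∈ φ.tail) (hker : f.toSubmodule ≤ LinearMap.ker T) {c : ℝ} (hc : 0 ≤ c) :
    Layered R φ (T + c • S.coProj f) := by
  obtain ⟨l, hl0, hl, Hl, hR⟩ := h
  have hshift : ∀ a, 0 ≤ a → filt (T + c • S.coProj f) (c + a) = filt T a := fun a ha => by
    rw [filt_add_coProj_of_le hT hker hc (by linarith), add_sub_cancel_left]
  refine ⟨c + l, by positivity, by rwa [hshift l hl0], fun a ha hal => ?_, R.congr ?_ hR⟩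
  · rcases lt_or_ge a c with hac | hca
    · rw [filt_add_coProj_of_lt hT hker ha hac]
      exact ⟨⟨f, (Flag.mem_tail.1 hf).1, rfl⟩, (Flag.lt_max_of_mem_tail hf).not_ge⟩
    · rw [filt_add_coProj_of_le hT hker hc hca]
      exact Hl _ (by linarith) (by linarith)
  · intro a ha
    rw [add_assoc, hshift _ (by positivity)]

/-- The cone over a butterfly. -/
def InCone (R : CellRule g) (φ : Flag S) (T : Module.End ℝ g) : Prop :=
  ∃ (T₀ : Module.End ℝ g) (c : LieSubalgebra ℝ g → ℝ), S.IsPositive T₀ ∧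
    φ.max.toSubmodule ≤ LinearMap.ker T₀ ∧ R.rule φ.max (filt T₀) ∧ (∀ f, 0 ≤ c f) ∧
    T = T₀ + ∑ f ∈ φ.tail, c f • S.coProj f

theorem InCone.layered (h : InCone R φ T) : Layered R φ T := by
  obtain ⟨T₀, c, hT₀, hker, hR, hc, rfl⟩ := h
  have key : ∀ s : Finset (LieSubalgebra ℝ g), s ⊆ φ.tail →
      Layered R φ (T₀ + ∑ f ∈ s, c f • S.coProj f) := by
    classical
    intro s
    induction s using Finset.strongInduction with
    | H s ih =>
      intro hs
      rcases s.eq_empty_or_nonempty with rfl | hne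
      · exact ⟨0, le_rfl, by simpa using hker.trans (ker_le_filt T₀ le_rfl),
          fun a ha ha' => by linarith, by simpa using hR⟩
      -- The smallest member is added last: `k` lies in all the others and so in the kernel of the
      -- sum already formed.
      · obtain ⟨k, hk⟩ := s.exists_minimal hne
        have hks := hk.prop
        have hmin : ∀ f ∈ s, k ≤ f := fun f hf =>
          (φ.chain.total (Flag.mem_tail.1 (hs hks)).1 (Flag.mem_tail.1 (hs hf)).1).elim id
            fun h => hk.le_of_le hf h
        rw [← Finset.sum_erase_add _ _ hks, ← add_assoc]
        refine (ih _ (Finset.erase_ssubset hks) ((Finset.erase_subset _ _).trans hs)).add_coProj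
          (hT₀.add (IsPositive.sum fun f hf => ?_)) (hs hks) (fun X hX => ?_) (hc k)
        · have hf' := (Flag.mem_tail.1 (hs (Finset.mem_of_mem_erase hf))).1
          exact (isPositive_coProj (φ.inv f hf')).smul (hc f)
        · rw [LinearMap.mem_ker, LinearMap.add_apply, LinearMap.sum_apply,
            LinearMap.mem_ker.1 (hker ((Flag.lt_max_of_mem_tail (hs hks)).le hX)), zero_add]
          refine Finset.sum_eq_zero fun f hf => ?_
          rw [LinearMap.smul_apply, coProj_of_mem (hmin f (Finset.mem_of_mem_erase hf) hX),
            smul_zero]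
  exact key _ subset_rfl

theorem Layered.inCone (h : Layered R φ T) (hT : S.IsPositive T) : InCone R φ T := by
  -- Induction on the rank of `T`, which drops with each peeling.
  induction hn : Module.finrank ℝ g - Module.finrank ℝ (LinearMap.ker T) using
    Nat.strong_induction_on generalizing T with
  | _ n ih =>
    obtain ⟨l, hl0, hl, Hl, hR⟩ := h
    rcases hl0.eq_or_lt with rfl | hlpos
    · exact ⟨T, 0, hT, hT.filt_zero ▸ hl, by simpa using hR, fun _ => le_rfl, by simp⟩
    obtain ⟨⟨f, hf, hfa⟩, hnot⟩ := Hl 0 le_rfl hlpos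
    rw [hT.filt_zero] at hfa hnot
    have hftail : f ∈ φ.tail := Flag.mem_tail.2 ⟨hf, fun h => hnot (h ▸ hfa.le)⟩
    have h0 : T ≠ 0 := by
      rintro rfl
      simp at hnot
    obtain ⟨T', c, hc, hT', hlt, hTT'⟩ := exists_peel hT hfa (φ.inv f hf) h0
    have hker : f.toSubmodule ≤ LinearMap.ker T' := hfa ▸ hlt.le
    -- Otherwise the filtration would still equal `ker T` at level `l`, which does not contain
    -- `φ.max`.
    have hcl : c ≤ l := by
      by_contra hcl
      rw [hTT', filt_add_coProj_of_lt hT' hker hl0 (not_le.1 hcl), hfa] at hl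
      exact hnot hl
    have hshift : ∀ a, 0 ≤ a → filt T (c + a) = filt T' a := fun a ha => by
      rw [hTT', filt_add_coProj_of_le hT' hker hc.le (by linarith), add_sub_cancel_left]
    have hlayer : Layered R φ T' := by
      refine ⟨l - c, by linarith, ?_, fun a ha hal => ?_, R.congr (fun a ha => ?_) hR⟩
      · rwa [← hshift _ (by linarith), add_sub_cancel]
      · rw [← hshift a ha]
        exact Hl _ (by linarith) (by linarith)
      · rw [← hshift _ (by linarith), ← add_assoc, add_sub_cancel]
    have hrank := Submodule.finrank_lt_finrank_of_lt hlt
    have hrank' := Submodule.finrank_le (LinearMap.ker T')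
    obtain ⟨T₀, d, hT₀, hker₀, hR₀, hd, hTd⟩ := ih _ (by omega) hlayer hT' rfl
    classical
    refine ⟨T₀, fun k => d k + if k = f then c else 0, hT₀, hker₀, hR₀, fun k => ?_, ?_⟩
    · have := hd k
      dsimp only
      split_ifs <;> positivity
    · rw [hTT', hTd]
      simp only [add_smul, Finset.sum_add_distrib, ite_smul, zero_smul, Finset.sum_ite_eq', hftail,
        if_true, add_assoc]

/-! ### Butterflies as slices of cones -/

theorem finrank_quotient_pos {f : LieSubalgebra ℝ g} (hf : f ≠ ⊤) :
    (0 : ℝ) < Module.finrank ℝ (g ⧸ f.toSubmodule) := by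
  have : Nontrivial (g ⧸ f.toSubmodule) := Submodule.Quotient.nontrivial_iff.2 fun h =>
    hf (LieSubalgebra.toSubmodule_injective (by simpa using h))
  exact_mod_cast Module.finrank_pos

theorem chiBar_eq (f : LieSubalgebra ℝ g) :
    S.chiBar f = (Module.finrank ℝ (g ⧸ f.toSubmodule) : ℝ)⁻¹ • S.coProj f := rfl

theorem isState_chiBar {f : LieSubalgebra ℝ g} (hinv : S.IsInvariant f) (hf : f ≠ ⊤) :
    S.IsState (S.chiBar f) := by
  have hpos := finrank_quotient_pos hf
  rw [isState_iff, chiBar_eq]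
  refine ⟨(isPositive_coProj hinv).smul (by positivity), ?_⟩
  rw [map_smul, trace_coProj, smul_eq_mul, inv_mul_cancel₀ hpos.ne']

theorem mem_convexHull_chiBar {s : Finset (LieSubalgebra ℝ g)} :
    T ∈ convexHull ℝ (S.chiBar '' s) ↔ ∃ w : LieSubalgebra ℝ g → ℝ, (∀ f, 0 ≤ w f) ∧
      ∑ f ∈ s, w f = 1 ∧ T = ∑ f ∈ s, w f • S.chiBar f := by
  classical
  constructor
  · intro h
    refine convexHull_min (t := {T | ∃ w : LieSubalgebra ℝ g → ℝ, (∀ f, 0 ≤ w f) ∧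
      ∑ f ∈ s, w f = 1 ∧ T = ∑ f ∈ s, w f • S.chiBar f}) ?_ ?_ h
    · rintro _ ⟨f, hf, rfl⟩
      rw [Finset.mem_coe] at hf
      refine ⟨fun k => if k = f then 1 else 0, fun k => ?_, by simp [hf], by simp [hf]⟩
      dsimp only
      split_ifs <;> norm_num
    · rintro _ ⟨w, hw, hw1, rfl⟩ _ ⟨w', hw', hw1', rfl⟩ a b ha hb hab
      refine ⟨fun f => a * w f + b * w' f,
        fun f => add_nonneg (mul_nonneg ha (hw f)) (mul_nonneg hb (hw' f)), ?_, ?_⟩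
      · rw [Finset.sum_add_distrib, ← Finset.mul_sum, ← Finset.mul_sum, hw1, hw1']
        linarith
      · simp only [add_smul, Finset.sum_add_distrib, Finset.smul_sum, mul_smul]
  · rintro ⟨w, hw, hw1, rfl⟩
    exact (convex_convexHull ℝ _).sum_mem (fun f _ => hw f) hw1
      fun f hf => subset_convexHull ℝ _ ⟨f, hf, rfl⟩

open Classical in
theorem butterfly_eq (S : InvariantData g) (V : LieSubalgebra ℝ g → Set (Module.End ℝ g))
    (φ : Flag S) : S.butterfly V φ =
      if φ.tail = ∅ then (if φ.max = ⊤ then ∅ else V φ.max)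
      else if φ.max = ⊤ then convexHull ℝ (S.chiBar '' φ.tail)
      else convexJoin ℝ (V φ.max) (convexHull ℝ (S.chiBar '' φ.tail)) := by
  unfold butterfly
  simp only [Flag.length_eq_one_iff, Flag.top_mem_iff, Flag.coe_tail]
  by_cases h : φ.tail = ∅
  · simp [h]
  · by_cases h' : φ.max = ⊤ <;> simp [h, h']

variable {V : LieSubalgebra ℝ g → Set (Module.End ℝ g)}

theorem convexHull_tail_subset : convexHull ℝ (S.chiBar '' φ.tail) ⊆ {T | S.IsState T} := by
  refine convexHull_min ?_ convex_isState
  rintro _ ⟨f, hf, rfl⟩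
  exact isState_chiBar (φ.inv f (Flag.mem_tail.1 hf).1) (Flag.ne_top_of_mem_tail hf)

theorem chiBar_mem_cell (hV : S.IsCellFamily R V) {f : LieSubalgebra ℝ g} (hf : S.h < f)
    (hinv : S.IsInvariant f) (htop : f ≠ ⊤) : S.chiBar f ∈ V f := by
  have hpos := finrank_quotient_pos htop
  refine (hV f hf _).2 ⟨isState_chiBar hinv htop, fun X hX => ?_, R.const (filt_mono _) ?_⟩
  · simp [chiBar_eq, coProj_of_mem hX]
  · intro a ha
    rw [chiBar_eq, ← zero_add (_ • S.coProj f)]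
    rcases lt_or_ge a (Module.finrank ℝ (g ⧸ f.toSubmodule) : ℝ)⁻¹ with h | h
    · exact Or.inl (filt_add_coProj_of_lt IsPositive.zero (by simp) ha h)
    · rw [filt_add_coProj_of_le IsPositive.zero (by simp) (by positivity) h]
      exact Or.inr (filt_zero_operator (by linarith))

theorem inCone_of_mem_convexHull (h : T ∈ convexHull ℝ (S.chiBar '' φ.tail))
    {T₀ : Module.End ℝ g} (hT₀ : S.IsPositive T₀) (hker : φ.max.toSubmodule ≤ LinearMap.ker T₀)
    (hR : R.rule φ.max (filt T₀)) {b : ℝ} (hb : 0 ≤ b) : InCone R φ (T₀ + b • T) := by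
  obtain ⟨w, hw, -, rfl⟩ := mem_convexHull_chiBar.1 h
  refine ⟨T₀, fun f => b * (w f * (Module.finrank ℝ (g ⧸ f.toSubmodule) : ℝ)⁻¹), hT₀, hker, hR,
    fun f => ?_, ?_⟩
  · have := hw f
    positivity
  · simp only [Finset.smul_sum, chiBar_eq, smul_smul]

theorem isState_and_inCone_of_mem_butterfly (hV : S.IsCellFamily R V)
    (h : T ∈ S.butterfly V φ) : S.IsState T ∧ InCone R φ T := by
  have hφ := φ.h_lt _ φ.max_mem
  rw [butterfly_eq] at h
  split_ifs at h with h₁ h₂ h₂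
  · exact h.elim
  · obtain ⟨hT, hker, hR⟩ := (hV _ hφ T).1 h
    exact ⟨hT, T, 0, (isState_iff.1 hT).1, hker, hR, fun _ => le_rfl, by simp⟩
  · refine ⟨convexHull_tail_subset h, ?_⟩
    have := inCone_of_mem_convexHull (R := R) h IsPositive.zero (by simp)
      (R.const (filt_mono _) fun a ha => Or.inr (filt_zero_operator ha)) zero_le_one
    rwa [one_smul, zero_add] at this
  · obtain ⟨T₀, hT₀, T₁, hT₁, hseg⟩ := mem_convexJoin.1 h
    obtain ⟨hs, hker, hR⟩ := (hV _ hφ T₀).1 hT₀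
    refine ⟨convex_isState.segment_subset hs (convexHull_tail_subset hT₁) hseg, ?_⟩
    obtain ⟨a, b, ha, hb, -, rfl⟩ := hseg
    refine inCone_of_mem_convexHull hT₁ ((isState_iff.1 hs).1.smul ha) (fun X hX => ?_)
      (rule_smul hR ha) hb
    simp [LinearMap.mem_ker.1 (hker hX)]

theorem InCone.mem_butterfly (hV : S.IsCellFamily R V) (h : InCone R φ T) (hT : S.IsState T) :
    T ∈ S.butterfly V φ := by
  have hφ := φ.h_lt _ φ.max_mem
  obtain ⟨T₀, c, hT₀, hker, hR, hc, hTeq⟩ := h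
  have hzero : φ.max = ⊤ → T₀ = 0 := fun h => by
    rw [h] at hker
    exact LinearMap.ker_eq_top.1 (top_le_iff.1 (by simpa using hker))
  let d : LieSubalgebra ℝ g → ℝ := fun f => Module.finrank ℝ (g ⧸ f.toSubmodule)
  have hd : ∀ f ∈ φ.tail, d f ≠ 0 := fun f hf =>
    (finrank_quotient_pos (Flag.ne_top_of_mem_tail hf)).ne'
  have hd0 : ∀ f, 0 ≤ d f := fun f => Nat.cast_nonneg _
  have hcd : ∀ f, 0 ≤ c f * d f := fun f => mul_nonneg (hc f) (hd0 f)
  have hsum : ∑ f ∈ φ.tail, c f • S.coProj f = ∑ f ∈ φ.tail, (c f * d f) • S.chiBar f := by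
    refine Finset.sum_congr rfl fun f hf => ?_
    rw [chiBar_eq, smul_smul, mul_assoc, mul_inv_cancel₀ (hd f hf), mul_one]
  have htrace : LinearMap.trace ℝ g T₀ + ∑ f ∈ φ.tail, c f * d f = 1 := by
    have := (isState_iff.1 hT).2
    rw [hTeq, map_add, map_sum] at this
    simpa [trace_coProj, d] using this
  rw [hsum] at hTeq
  rw [butterfly_eq]
  split_ifs with h₁ h₂ h₂
  · rw [h₁, hzero h₂] at htrace
    simp at htrace
  · rw [h₁, Finset.sum_empty, add_zero] at hTeq
    subst hTeq
    exact (hV _ hφ _).2 ⟨hT, hker, hR⟩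
  · rw [hzero h₂, zero_add] at hTeq
    rw [hzero h₂, map_zero, zero_add] at htrace
    exact mem_convexHull_chiBar.2 ⟨_, hcd, htrace, hTeq⟩
  · obtain ⟨htr0, htr⟩ := hT₀.trace_nonneg
    -- If `T₀` has trace zero it vanishes, and `T` lies in the simplex. A point of the cell is still
    -- needed as an endpoint of the segment; `χ̄` of the maximum provides it.
    rcases htr0.eq_or_lt with ht | ht
    · rw [htr ht.symm, zero_add] at hTeq
      rw [← ht, zero_add] at htrace
      exact mem_convexJoin.2 ⟨_, chiBar_mem_cell hV hφ (φ.inv _ φ.max_mem) h₂, T,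
        mem_convexHull_chiBar.2 ⟨_, hcd, htrace, hTeq⟩, right_mem_segment ℝ _ _⟩
    set t := LinearMap.trace ℝ g T₀
    have hcell : t⁻¹ • T₀ ∈ V φ.max := by
      refine (hV _ hφ _).2 ⟨isState_iff.2 ⟨hT₀.smul (by positivity), ?_⟩, fun X hX => ?_,
        rule_smul hR (by positivity)⟩
      · rw [map_smul, smul_eq_mul, inv_mul_cancel₀ ht.ne']
      · simp [LinearMap.mem_ker.1 (hker hX)]
    have hw0 : 0 ≤ ∑ f ∈ φ.tail, c f * d f := Finset.sum_nonneg fun f _ => hcd f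
    rcases hw0.eq_or_lt with hw | hw
    -- All weights vanish, so `T` is the cell endpoint and any vertex of the simplex serves as the
    -- other.
    · obtain ⟨k, hk⟩ := Finset.nonempty_iff_ne_empty.2 h₁
      refine mem_convexJoin.2 ⟨_, hcell, S.chiBar k, subset_convexHull ℝ _ ⟨k, hk, rfl⟩, ?_⟩
      have h0 := (Finset.sum_eq_zero_iff_of_nonneg fun f _ => hcd f).1 hw.symm
      rw [Finset.sum_eq_zero fun f hf => by rw [h0 f hf, zero_smul], add_zero] at hTeq
      have ht1 : t = 1 := by linarith
      rw [hTeq, ht1, inv_one, one_smul]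
      exact left_mem_segment ℝ _ _
    · set w := ∑ f ∈ φ.tail, c f * d f
      refine mem_convexJoin.2 ⟨_, hcell, _, mem_convexHull_chiBar.2
        ⟨fun f => w⁻¹ * (c f * d f), fun f => mul_nonneg (by positivity) (hcd f), ?_, rfl⟩,
        t, w, ht.le, hw.le, htrace, ?_⟩
      · rw [← Finset.mul_sum, inv_mul_cancel₀ hw.ne']
      · simp only [mul_smul w⁻¹]
        rw [hTeq, ← Finset.smul_sum, smul_inv_smul₀ ht.ne', smul_inv_smul₀ hw.ne']

theorem mem_butterfly_iff (hV : S.IsCellFamily R V) :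
    T ∈ S.butterfly V φ ↔ S.IsState T ∧ Layered R φ T := by
  constructor
  · intro h
    obtain ⟨h₁, h₂⟩ := isState_and_inCone_of_mem_butterfly hV h
    exact ⟨h₁, h₂.layered⟩
  · rintro ⟨h₁, h₂⟩
    exact (h₂.inCone (isState_iff.1 h₁).1).mem_butterfly hV h₁

theorem butterfly_inter (hV : S.IsCellFamily R V) (φ ψ : Flag S) :
    S.butterfly V φ ∩ S.butterfly V ψ = S.butterfly V (φ * ψ) := by
  ext T
  rw [Set.mem_inter_iff, mem_butterfly_iff hV, mem_butterfly_iff hV, mem_butterfly_iff hV]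
  constructor
  · rintro ⟨⟨hT, h₁⟩, -, h₂⟩
    exact ⟨hT, h₁.mul h₂⟩
  · rintro ⟨hT, h⟩
    obtain ⟨h₁, h₂⟩ := (layered_mul_iff hT.1).1 h
    exact ⟨⟨hT, h₁⟩, hT, h₂⟩

end InvariantData

end

end ButterflyFlags

open ButterflyFlags InvariantData in
theorem proposition5p4 {g : Type*} [LieRing g] [LieAlgebra ℝ g] [FiniteDimensional ℝ g]
    (S : InvariantData g) :
    -- intersections of butterflies, in both versions
    (∀ φ ψ : Flag S, S.butterflyX φ ∩ S.butterflyX ψ = S.butterflyX (φ * ψ)) ∧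
    (∀ φ ψ : Flag S, S.butterflyD φ ∩ S.butterflyD ψ = S.butterflyD (φ * ψ)) ∧
    -- the product of flags is commutative, associative and idempotent
    (∀ φ ψ : Flag S, φ * ψ = ψ * φ) ∧
    (∀ φ ψ χ : Flag S, (φ * ψ) * χ = φ * (ψ * χ)) ∧
    (∀ φ : Flag S, φ * φ = φ) ∧
    -- the nonstandard order is a partial order, with the following explicit description
    IsPartialOrder (Flag S) (fun φ ψ => φ ≤ ψ) ∧
    (∀ φ ψ : Flag S, φ ≤ ψ ↔
      φ.max ≤ ψ.max ∧ ∀ l ∈ ψ.carrier, l ∉ φ.carrier → φ.max < l) ∧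
    -- the product is the least upper bound
    (∀ φ ψ : Flag S, IsLUB {φ, ψ} (φ * ψ)) := by
  exact ⟨butterfly_inter isCellFamily_cellX, butterfly_inter isCellFamily_cellD, Flag.mul_comm',
    Flag.mul_assoc', Flag.mul_self, Flag.isPartialOrder, fun _ _ => Flag.le_iff_below,
    Flag.isLUB_mul⟩
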